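/- Let $\mathfrak{C}$ be a semistrict monoidal 2-category (Gray monoid) with product $\Box$, unit $\mathbf I$ and 2-fiber products, and let $\mathfrak{M}$ be a $\mathfrak{C}$-enriched 2-category with hom objects $\mathfrak{M}[x,y]$, composition 1-morphisms $m_{x,y,z}\colon\mathfrak{M}[y,z]\,\Box\,\mathfrak{M}[x,y]\to\mathfrak{M}[x,z]$, enriched associators and unitors. A 1-morphism $f\colon x\to y$ of the underlying 2-category of $\mathfrak{M}$ is a 1-morphism $f^\sharp\colon\mathbf I\to\mathfrak{M}[x,y]$ of $\mathfrak{C}$. It induces a push-forward $f_*\colon\mathfrak{M}[s,x]\to\mathfrak{M}[s,y]$ and a pullback $f^*\colon\mathfrak{M}[y,s]\to\mathfrak{M}[x,s]$, namely $f^\sharp\,\Box\,1$, respectively $1\,\Box\,f^\sharp$, followed by $m$. The enriched associator and the interchanger of $\mathfrak{C}$ give canonical 2-isomorphisms $(g\circ f)_*\cong g_*\circ f_*$, $(g\circ f)^*\cong f^*\circ g^*$ and $g_*\circ f^*\cong f^*\circ g_*$. Put $A_x=\mathfrak{M}[x,x]$, and for $f\colon x\to y$ let $A_f$, with projections $p_x\colon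 A_f\to A_x$ and $p_y\colon A_f\to A_y$ and a 2-isomorphism $\varpi_f\colon f_*p_x\cong f^*p_y$, be a 2-fiber product of $A_x\xrightarrow{f_*}\mathfrak{M}[x,y]\xleftarrow{f^*}A_y$ in $\mathfrak{C}$. For composable $x\xrightarrow{f}y\xrightarrow{g}z$ let $A_f\times_{A_y}A_g$ be the 2-fiber product of $A_f\xrightarrow{p_y}A_y\xleftarrow{p_y}A_g$. Pasting its 2-isomorphism with $\varpi_f$, $\varpi_g$ and $g_*f^*\cong f^*g_*$ gives a square over $(g\circ f)_*$ and $(g\circ f)^*$, and the 2-universal property of $A_{g\circ f}$ then gives the laxator $$\Phi_{f,g}\colon A_f\times_{A_y}A_g\longrightarrow A_{g\circ f}$$ together with 2-isomorphisms expressing that it commutes with the projections to $A_x$ and to $A_z$ and is compatible with the two squares. **Theorem.** Let $x\xrightarrow{f}y\xrightarrow{g}z\xrightarrow{h}w$ be composable 1-morphisms of $\mathfrak{M}$. Let $A_f\times_{A_y}A_g\times_{A_z}A_h$ be the 2-fiber product of the projections $A_f\times_{A_y}A_g\to A_g\leftarrow A_g\times_{A_z}A_h$, and let $\Phi_{f,g}1$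 and $1\Phi_{g,h}$ be the 1-morphisms induced by $\Phi_{f,g}$ and $\Phi_{g,h}$ on 2-fiber products. Identify $A_{(h\circ g)\circ f}$ with $A_{h\circ(g\circ f)}$ along the 1-morphism induced by the associator $(h\circ g)\circ f\cong h\circ(g\circ f)$ of the underlying 2-category of $\mathfrak{M}$, and write $A_{h\circ g\circ f}$ for both. Then there is a canonical 2-isomorphism in $\mathfrak{C}$ $$\Phi_{f,g,h}\colon\ \Phi_{gf,h}\circ(\Phi_{f,g}1)\ \Longrightarrow\ \Phi_{f,hg}\circ(1\Phi_{g,h})$$ between the two composites $A_f\times_{A_y}A_g\times_{A_z}A_h\to A_{h\circ g\circ f}$. It is the unique 2-isomorphism whose whiskerings with the projections $A_{h\circ g\circ f}\to A_x$ and $A_{h\circ g\circ f}\to A_w$ are the composites of the structure 2-isomorphisms, by which both composites commute with the projections of $A_f\times_{A_y}A_g\times_{A_z}A_h$ to $A_x$ (through $A_f$) and to $A_w$ (through $A_h$). This holds for every choice of the 2-fiber products and of the induced 1-morphisms. -/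

import Mathlib

open CategoryTheory Bicategory

universe w v u u'

namespace LaxSpan

/-! ### Semistrict monoidal 2-categories -/

/-- A semistrict monoidal 2-category (Gray monoid): a monoid for the Gray tensor product of strict
2-categories.  `A ⊡ -` and `- ⊡ B` are strict 2-functors (`wl`, `wl₂` and `wr`, `wr₂` on 1-cells
and 2-cells), the product is strictly associative and unital, and the exchange law for 1-cells
holds up to the invertible interchanger.  Strict equalities between 1-cells (or 2-cells) whose
boundaries are only propositionally equal are written by composing with `eqToHom`. -/
class GrayMonoid (C : Type u) [Bicategory.{w, v} C] [Bicategory.Strict C] where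
  tensorObj : C → C → C
  unit : C
  /-- The strict 2-functor `A ⊡ -`. -/
  wl (A : C) {B B' : C} (g : B ⟶ B') : tensorObj A B ⟶ tensorObj A B'
  wl₂ (A : C) {B B' : C} {g g' : B ⟶ B'} (θ : g ⟶ g') : wl A g ⟶ wl A g'
  wl_id (A B : C) : wl A (𝟙 B) = 𝟙 (tensorObj A B)
  wl_comp (A : C) {B B' B'' : C} (g : B ⟶ B') (g' : B' ⟶ B'') :
    wl A (g ≫ g') = wl A g ≫ wl A g'
  wl₂_id (A : C) {B B' : C} (g : B ⟶ B') : wl₂ A (𝟙 g) = 𝟙 (wl A g)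
  wl₂_comp (A : C) {B B' : C} {g g' g'' : B ⟶ B'} (θ : g ⟶ g') (θ' : g' ⟶ g'') :
    wl₂ A (θ ≫ θ') = wl₂ A θ ≫ wl₂ A θ'
  wl₂_whiskerLeft (A : C) {B B' B'' : C} (g : B ⟶ B') {k k' : B' ⟶ B''} (θ : k ⟶ k') :
    wl₂ A (g ◁ θ) = eqToHom (wl_comp A g k) ≫ wl A g ◁ wl₂ A θ ≫ eqToHom (wl_comp A g k').symm
  wl₂_whiskerRight (A : C) {B B' B'' : C} {g g' : B ⟶ B'} (θ : g ⟶ g') (k : B' ⟶ B'') :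
    wl₂ A (θ ▷ k) = eqToHom (wl_comp A g k) ≫ wl₂ A θ ▷ wl A k ≫ eqToHom (wl_comp A g' k).symm
  /-- The strict 2-functor `- ⊡ B`. -/
  wr {A A' : C} (f : A ⟶ A') (B : C) : tensorObj A B ⟶ tensorObj A' B
  wr₂ {A A' : C} {f f' : A ⟶ A'} (η : f ⟶ f') (B : C) : wr f B ⟶ wr f' B
  wr_id (A B : C) : wr (𝟙 A) B = 𝟙 (tensorObj A B)
  wr_comp {A A' A'' : C} (f : A ⟶ A') (f' : A' ⟶ A'') (B : C) :
    wr (f ≫ f') B = wr f B ≫ wr f' B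
  wr₂_id {A A' : C} (f : A ⟶ A') (B : C) : wr₂ (𝟙 f) B = 𝟙 (wr f B)
  wr₂_comp {A A' : C} {f f' f'' : A ⟶ A'} (η : f ⟶ f') (η' : f' ⟶ f'') (B : C) :
    wr₂ (η ≫ η') B = wr₂ η B ≫ wr₂ η' B
  wr₂_whiskerLeft {A A' A'' : C} (f : A ⟶ A') {k k' : A' ⟶ A''} (η : k ⟶ k') (B : C) :
    wr₂ (f ◁ η) B = eqToHom (wr_comp f k B) ≫ wr f B ◁ wr₂ η B ≫ eqToHom (wr_comp f k' B).symm
  wr₂_whiskerRight {A A' A'' : C} {f f' : A ⟶ A'} (η : f ⟶ f') (k : A' ⟶ A'') (B : C) :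
    wr₂ (η ▷ k) B = eqToHom (wr_comp f k B) ≫ wr₂ η B ▷ wr k B ≫ eqToHom (wr_comp f' k B).symm
  /-- Strict unitality. -/
  unit_tensor (A : C) : tensorObj unit A = A
  tensor_unit (A : C) : tensorObj A unit = A
  unit_wl {B B' : C} (g : B ⟶ B') :
    wl unit g ≫ eqToHom (unit_tensor B') = eqToHom (unit_tensor B) ≫ g
  wr_unit {A A' : C} (f : A ⟶ A') :
    wr f unit ≫ eqToHom (tensor_unit A') = eqToHom (tensor_unit A) ≫ f
  unit_wl₂ {B B' : C} {g g' : B ⟶ B'} (θ : g ⟶ g') :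
    wl₂ unit θ ▷ eqToHom (unit_tensor B') =
      eqToHom (unit_wl g) ≫ eqToHom (unit_tensor B) ◁ θ ≫ eqToHom (unit_wl g').symm
  wr₂_unit {A A' : C} {f f' : A ⟶ A'} (η : f ⟶ f') :
    wr₂ η unit ▷ eqToHom (tensor_unit A') =
      eqToHom (wr_unit f) ≫ eqToHom (tensor_unit A) ◁ η ≫ eqToHom (wr_unit f').symm
  /-- Strict associativity, on objects, on 1-cells and on 2-cells. -/
  tensor_assoc (A B D : C) : tensorObj (tensorObj A B) D = tensorObj A (tensorObj B D)
  wr_wr {A A' : C} (f : A ⟶ A') (B D : C) :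
    wr (wr f B) D ≫ eqToHom (tensor_assoc A' B D) =
      eqToHom (tensor_assoc A B D) ≫ wr f (tensorObj B D)
  wr_wl (A : C) {B B' : C} (g : B ⟶ B') (D : C) :
    wr (wl A g) D ≫ eqToHom (tensor_assoc A B' D) =
      eqToHom (tensor_assoc A B D) ≫ wl A (wr g D)
  wl_wl (A B : C) {D D' : C} (h : D ⟶ D') :
    wl (tensorObj A B) h ≫ eqToHom (tensor_assoc A B D') =
      eqToHom (tensor_assoc A B D) ≫ wl A (wl B h)
  wr₂_wr₂ {A A' : C} {f f' : A ⟶ A'} (η : f ⟶ f') (B D : C) :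
    wr₂ (wr₂ η B) D ▷ eqToHom (tensor_assoc A' B D) =
      eqToHom (wr_wr f B D) ≫ eqToHom (tensor_assoc A B D) ◁ wr₂ η (tensorObj B D) ≫
        eqToHom (wr_wr f' B D).symm
  wr₂_wl₂ (A : C) {B B' : C} {g g' : B ⟶ B'} (θ : g ⟶ g') (D : C) :
    wr₂ (wl₂ A θ) D ▷ eqToHom (tensor_assoc A B' D) =
      eqToHom (wr_wl A g D) ≫ eqToHom (tensor_assoc A B D) ◁ wl₂ A (wr₂ θ D) ≫
        eqToHom (wr_wl A g' D).symm
  wl₂_wl₂ (A B : C) {D D' : C} {h h' : D ⟶ D'} (κ : h ⟶ h') :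
    wl₂ (tensorObj A B) κ ▷ eqToHom (tensor_assoc A B D') =
      eqToHom (wl_wl A B h) ≫ eqToHom (tensor_assoc A B D) ◁ wl₂ A (wl₂ B κ) ≫
        eqToHom (wl_wl A B h').symm
  /-- The interchanger. -/
  inter {A A' B B' : C} (f : A ⟶ A') (g : B ⟶ B') : wl A g ≫ wr f B' ≅ wr f B ≫ wl A' g
  inter_naturality_left {A A' B B' : C} {f f' : A ⟶ A'} (η : f ⟶ f') (g : B ⟶ B') :
    wl A g ◁ wr₂ η B' ≫ (inter f' g).hom = (inter f g).hom ≫ wr₂ η B ▷ wl A' g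
  inter_naturality_right {A A' B B' : C} (f : A ⟶ A') {g g' : B ⟶ B'} (θ : g ⟶ g') :
    wl₂ A θ ▷ wr f B' ≫ (inter f g').hom = (inter f g).hom ≫ wr f B ◁ wl₂ A' θ
  inter_id_left (A : C) {B B' : C} (g : B ⟶ B') :
    (inter (𝟙 A) g).hom =
      eqToHom (by rw [wr_id, wr_id, Strict.comp_id, Strict.id_comp])
  inter_id_right {A A' : C} (f : A ⟶ A') (B : C) :
    (inter f (𝟙 B)).hom =
      eqToHom (by rw [wl_id, wl_id, Strict.comp_id, Strict.id_comp])
  inter_comp_left {A A' A'' B B' : C} (f : A ⟶ A') (f' : A' ⟶ A'') (g : B ⟶ B') :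
    (inter (f ≫ f') g).hom =
      eqToHom (by rw [wr_comp, Strict.assoc]) ≫ (inter f g).hom ▷ wr f' B' ≫
        eqToHom (Strict.assoc _ _ _) ≫ wr f B ◁ (inter f' g).hom ≫
          eqToHom (by rw [wr_comp, Strict.assoc])
  inter_comp_right {A A' B B' B'' : C} (f : A ⟶ A') (g : B ⟶ B') (g' : B' ⟶ B'') :
    (inter f (g ≫ g')).hom =
      eqToHom (by rw [wl_comp, Strict.assoc]) ≫ wl A g ◁ (inter f g').hom ≫
        eqToHom (Strict.assoc _ _ _).symm ≫ (inter f g).hom ▷ wl A' g' ≫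
          eqToHom (by rw [wl_comp, Strict.assoc])
  /-- Compatibility of the interchanger with strict associativity. -/
  inter_wl (A : C) {B B' D D' : C} (g : B ⟶ B') (h : D ⟶ D') :
    (inter (wl A g) h).hom ▷ eqToHom (tensor_assoc A B' D') =
      eqToHom (by rw [Strict.assoc, wr_wl, ← Strict.assoc, wl_wl, Strict.assoc, ← wl_comp]) ≫
        eqToHom (tensor_assoc A B D) ◁ wl₂ A (inter g h).hom ≫
          eqToHom (by rw [Strict.assoc, wl_wl, ← Strict.assoc, wr_wl, Strict.assoc, ← wl_comp])
  inter_wr_wl {A A' D D' : C} (f : A ⟶ A') (B : C) (h : D ⟶ D') :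
    (inter (wr f B) h).hom ▷ eqToHom (tensor_assoc A' B D') =
      eqToHom (by rw [Strict.assoc, wr_wr, ← Strict.assoc, wl_wl, Strict.assoc]) ≫
        eqToHom (tensor_assoc A B D) ◁ (inter f (wl B h)).hom ≫
          eqToHom (by rw [Strict.assoc, wl_wl, ← Strict.assoc, ← Strict.assoc, ← wr_wr])
  inter_wr {A A' B B' : C} (f : A ⟶ A') (g : B ⟶ B') (D : C) :
    wr₂ (inter f g).hom D ▷ eqToHom (tensor_assoc A' B' D) =
      eqToHom (by rw [wr_comp, Strict.assoc, wr_wr, ← Strict.assoc, wr_wl, Strict.assoc]) ≫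
        eqToHom (tensor_assoc A B D) ◁ (inter f (wr g D)).hom ≫
          eqToHom (by rw [wr_comp, Strict.assoc, wr_wl, ← Strict.assoc, ← Strict.assoc, ← wr_wr])

open GrayMonoid

section Gray

variable {C : Type u} [Bicategory.{w, v} C] [Bicategory.Strict C] [GrayMonoid C]

infixr:70 " ⊡ " => GrayMonoid.tensorObj

variable (C) in
/-- The monoidal unit. -/
abbrev 𝕀 : C := GrayMonoid.unit

/-- The identity 1-cell `(A ⊡ B) ⊡ D = A ⊡ (B ⊡ D)`. -/
abbrev as (A B D : C) : (A ⊡ B) ⊡ D ⟶ A ⊡ (B ⊡ D) := eqToHom (tensor_assoc A B D)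

/-- The identity 1-cell `A ⊡ (B ⊡ D) = (A ⊡ B) ⊡ D`. -/
abbrev as' (A B D : C) : A ⊡ (B ⊡ D) ⟶ (A ⊡ B) ⊡ D := eqToHom (tensor_assoc A B D).symm

/-- The identity 1-cell `𝕀 ⊡ A = A`. -/
abbrev lu (A : C) : 𝕀 C ⊡ A ⟶ A := eqToHom (unit_tensor A)

/-- The identity 1-cell `A = 𝕀 ⊡ A`. -/
abbrev lu' (A : C) : A ⟶ 𝕀 C ⊡ A := eqToHom (unit_tensor A).symm

/-- The identity 1-cell `A ⊡ 𝕀 = A`. -/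
abbrev ru (A : C) : A ⊡ 𝕀 C ⟶ A := eqToHom (tensor_unit A)

/-- The identity 1-cell `A = A ⊡ 𝕀`. -/
abbrev ru' (A : C) : A ⟶ A ⊡ 𝕀 C := eqToHom (tensor_unit A).symm

/-- `A ⊡ -` on invertible 2-cells. -/
@[simps] def wlIso (A : C) {B B' : C} {g g' : B ⟶ B'} (θ : g ≅ g') : wl A g ≅ wl A g' where
  hom := wl₂ A θ.hom
  inv := wl₂ A θ.inv
  hom_inv_id := by rw [← wl₂_comp, θ.hom_inv_id, wl₂_id]
  inv_hom_id := by rw [← wl₂_comp, θ.inv_hom_id, wl₂_id]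

/-- `- ⊡ B` on invertible 2-cells. -/
@[simps] def wrIso {A A' : C} {f f' : A ⟶ A'} (η : f ≅ f') (B : C) : wr f B ≅ wr f' B where
  hom := wr₂ η.hom B
  inv := wr₂ η.inv B
  hom_inv_id := by rw [← wr₂_comp, η.hom_inv_id, wr₂_id]
  inv_hom_id := by rw [← wr₂_comp, η.inv_hom_id, wr₂_id]

theorem wl_eqToHom (A : C) {B B' : C} (e : B = B') :
    wl A (eqToHom e) = eqToHom (congrArg (fun X => A ⊡ X) e) := by
  subst e; exact wl_id A B

theorem wr_eqToHom {A A' : C} (e : A = A') (B : C) :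
    wr (eqToHom e) B = eqToHom (congrArg (fun X => X ⊡ B) e) := by
  subst e; exact wr_id A B

/-! Equalities between 1-cells, in the form in which rewriting uses them. -/

theorem wr_wr_assoc {A A' : C} (f : A ⟶ A') (B D : C) {Z : C} (k : A' ⊡ (B ⊡ D) ⟶ Z) :
    wr (wr f B) D ≫ as A' B D ≫ k = as A B D ≫ wr f (B ⊡ D) ≫ k := by
  rw [← Strict.assoc, wr_wr, Strict.assoc]

theorem wr_wl_assoc (A : C) {B B' : C} (g : B ⟶ B') (D : C) {Z : C} (k : A ⊡ (B' ⊡ D) ⟶ Z) :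
    wr (wl A g) D ≫ as A B' D ≫ k = as A B D ≫ wl A (wr g D) ≫ k := by
  rw [← Strict.assoc, wr_wl, Strict.assoc]

theorem wl_wl_assoc (A B : C) {D D' : C} (h : D ⟶ D') {Z : C} (k : A ⊡ (B ⊡ D') ⟶ Z) :
    wl (A ⊡ B) h ≫ as A B D' ≫ k = as A B D ≫ wl A (wl B h) ≫ k := by
  rw [← Strict.assoc, wl_wl, Strict.assoc]

theorem wr_as' {A A' : C} (f : A ⟶ A') (B D : C) {Z : C} (k : (A' ⊡ B) ⊡ D ⟶ Z) :
    wr f (B ⊡ D) ≫ as' A' B D ≫ k = as' A B D ≫ wr (wr f B) D ≫ k := by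
  have e : k = as A' B D ≫ as' A' B D ≫ k := by simp
  conv_rhs => rw [e, wr_wr_assoc]
  simp

theorem wl_as' (A B : C) {D D' : C} (h : D ⟶ D') {Z : C} (k : (A ⊡ B) ⊡ D' ⟶ Z) :
    wl A (wl B h) ≫ as' A B D' ≫ k = as' A B D ≫ wl (A ⊡ B) h ≫ k := by
  have e : k = as A B D' ≫ as' A B D' ≫ k := by simp
  conv_rhs => rw [e, wl_wl_assoc]
  simp

theorem lu'_wl {B B' : C} (g : B ⟶ B') {Z : C} (k : 𝕀 C ⊡ B' ⟶ Z) :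
    lu' B ≫ wl (𝕀 C) g ≫ k = g ≫ lu' B' ≫ k := by
  have e : k = lu B' ≫ lu' B' ≫ k := by simp
  conv_lhs => rw [e, ← Strict.assoc (wl _ _), unit_wl]
  simp

theorem ru'_wr {A A' : C} (f : A ⟶ A') {Z : C} (k : A' ⊡ 𝕀 C ⟶ Z) :
    ru' A ≫ wr f (𝕀 C) ≫ k = f ≫ ru' A' ≫ k := by
  have e : k = ru A' ≫ ru' A' ≫ k := by simp
  conv_lhs => rw [e, ← Strict.assoc (wr _ _), wr_unit]
  simp

theorem wr_eqToHom_right {A A' : C} (f : A ⟶ A') {B B' : C} (e : B = B') {Z : C}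
    (k : A' ⊡ B' ⟶ Z) :
    wr f B ≫ eqToHom (congrArg (fun X => A' ⊡ X) e) ≫ k =
      eqToHom (congrArg (fun X => A ⊡ X) e) ≫ wr f B' ≫ k := by
  subst e; simp

end Gray

/-! ### Enriched 2-categories -/

section Enriched

variable (C : Type u) [Bicategory.{w, v} C] [Bicategory.Strict C] [GrayMonoid C]

/-- A 2-category enriched over the semistrict monoidal 2-category `C`. -/
structure EnrichedBicategory where
  Obj : Type u'
  hom : Obj → Obj → C
  /-- enriched units -/
  j (x : Obj) : 𝕀 C ⟶ hom x x
  /-- enriched compositions -/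
  m (x y z : Obj) : hom y z ⊡ hom x y ⟶ hom x z
  /-- enriched unitors -/
  lam (x y : Obj) : wr (j y) (hom x y) ≫ m x y y ≅ lu (hom x y)
  rho (x y : Obj) : wl (hom x y) (j x) ≫ m x x y ≅ ru (hom x y)
  /-- enriched associators -/
  pi (x y z t : Obj) : wr (m y z t) (hom x y) ≫ m x y t ≅
    as (hom z t) (hom y z) (hom x y) ≫ wl (hom z t) (m x y z) ≫ m x z t
  /-- the associativity (pentagon) equation -/
  pentagon (x y z s t : Obj) :
    wr₂ (pi y z s t).hom (hom x y) ▷ m x y t ≫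
      eqToHom (by simp only [wr_comp, Strict.assoc]) ≫
      (wr (as (hom s t) (hom z s) (hom y z)) (hom x y) ≫ wr (wl (hom s t) (m y z s)) (hom x y)) ◁
        (pi x y s t).hom ≫
      eqToHom (by simp only [wl_comp, Strict.assoc, wr_wl_assoc]) ≫
      (wr (as (hom s t) (hom z s) (hom y z)) (hom x y) ≫
        as (hom s t) (hom z s ⊡ hom y z) (hom x y)) ◁
        (wl₂ (hom s t) (pi x y z s).hom ▷ m x s t) =
    eqToHom (by simp only [wr_comp, Strict.assoc]) ≫
      wr (wr (m z s t) (hom y z)) (hom x y) ◁ (pi x y z t).hom ≫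
      eqToHom (by simp only [Strict.assoc, wr_wr_assoc]) ≫
      (as (hom s t ⊡ hom z s) (hom y z) (hom x y) ◁ (inter (m z s t) (m x y z)).inv) ▷ m x z t ≫
      eqToHom (by simp only [Strict.assoc]) ≫
      (as (hom s t ⊡ hom z s) (hom y z) (hom x y) ≫ wl (hom s t ⊡ hom z s) (m x y z)) ◁
        (pi x z s t).hom ≫
      eqToHom (by
        simp only [wl_comp, Strict.assoc, wl_wl_assoc, wl_eqToHom, wr_eqToHom, as,
          eqToHom_trans_assoc])
  /-- the unitality (triangle) equation -/
  triangle (x y z : Obj) :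
    eqToHom (by simp only [wr_comp, Strict.assoc]) ≫
      wr₂ (rho y z).hom (hom x y) ▷ m x y z =
    wr (wl (hom y z) (j y)) (hom x y) ◁ (pi x y y z).hom ≫
      eqToHom (by simp only [wl_comp, Strict.assoc, wr_wl_assoc]) ≫
      (as (hom y z) (𝕀 C) (hom x y) ◁ wl₂ (hom y z) (lam x y).hom) ▷ m x y z ≫
      eqToHom (by simp only [wl_eqToHom, wr_eqToHom, as, lu, ru, eqToHom_trans])

end Enriched

namespace EnrichedBicategory

variable {C : Type u} [Bicategory.{w, v} C] [Bicategory.Strict C] [GrayMonoid C]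
variable (M : EnrichedBicategory.{w, v, u, u'} C)

/-- The category of 1-morphisms `x ⟶ y` of the underlying 2-category of `M`: its objects are the
1-cells `f♯ : 𝕀 ⟶ M[x, y]` of `C` and its morphisms are the 2-cells between them. -/
abbrev Mor (x y : M.Obj) : Type v := 𝕀 C ⟶ M.hom x y

variable {M} {x y z t : M.Obj}

/-- The composite `g ∘ f` in the underlying 2-category:
`𝕀 = 𝕀 ⊡ 𝕀 ⟶ M[y, z] ⊡ 𝕀 ⟶ M[y, z] ⊡ M[x, y] ⟶ M[x, z]`. -/
def compMor (f : M.Mor x y) (g : M.Mor y z) : M.Mor x z :=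
  ru' (𝕀 C) ≫ wr g (𝕀 C) ≫ wl (M.hom y z) f ≫ M.m x y z

/-- The push-forward `f_* : M[s, x] ⟶ M[s, y]`. -/
def post (f : M.Mor x y) (s : M.Obj) : M.hom s x ⟶ M.hom s y :=
  lu' (M.hom s x) ≫ wr f (M.hom s x) ≫ M.m s x y

/-- The pullback `f^* : M[y, s] ⟶ M[x, s]`. -/
def pre (f : M.Mor x y) (s : M.Obj) : M.hom y s ⟶ M.hom x s :=
  ru' (M.hom y s) ≫ wl (M.hom y s) f ≫ M.m x y s

/-- The push-forward along an invertible 2-cell. -/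
def postIso {f f' : M.Mor x y} (a : f ≅ f') (s : M.Obj) : post f s ≅ post f' s :=
  whiskerLeftIso _ (whiskerRightIso (wrIso a (M.hom s x)) _)

/-- The pullback along an invertible 2-cell. -/
def preIso {f f' : M.Mor x y} (a : f ≅ f') (s : M.Obj) : pre f s ≅ pre f' s :=
  whiskerLeftIso _ (whiskerRightIso (wlIso (M.hom y s) a) _)

theorem compMor_eq (f : M.Mor x y) (g : M.Mor y z) : compMor f g = g ≫ pre f z := by
  simp only [compMor, pre, ru'_wr]

/-- The canonical 2-isomorphism `(g ∘ f)^* ≅ f^* ∘ g^*`, given by the inverse enriched associator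
and the interchanger. -/
def preComp (f : M.Mor x y) (g : M.Mor y z) (s : M.Obj) :
    pre (compMor f g) s ≅ pre g s ≫ pre f s :=
  eqToIso (by
    have e := fun k : M.hom z s ⊡ M.hom y z ⊡ M.hom x y ⟶ M.hom x s =>
      (wl_wl_assoc (M.hom z s) (M.hom y z) f k).symm
    simp only [as] at e
    simp only [compMor_eq, pre, wl_comp, Strict.assoc, wl_eqToHom, ru']
    rw [← eqToHom_trans_assoc (tensor_unit _).symm (tensor_assoc _ _ _), e]) ≪≫
  whiskerLeftIso (ru' (M.hom z s) ≫ wl (M.hom z s) g ≫ ru' _ ≫ wl (M.hom z s ⊡ M.hom y z) f)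
    (M.pi x y z s).symm ≪≫
  eqToIso (by simp only [Strict.assoc]) ≪≫
  whiskerLeftIso (ru' (M.hom z s) ≫ wl (M.hom z s) g ≫ ru' _)
    (whiskerRightIso (inter (M.m y z s) f) (M.m x y s)) ≪≫
  eqToIso (by simp only [pre, Strict.assoc, ru'_wr])

/-- The canonical 2-isomorphism `(g ∘ f)_* ≅ g_* ∘ f_*`, given by the enriched associator and the
interchanger. -/
def postComp (f : M.Mor x y) (g : M.Mor y z) (s : M.Obj) :
    post (compMor f g) s ≅ post f s ≫ post g s :=
  eqToIso (by simp only [post, compMor, wr_comp, Strict.assoc]) ≪≫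
  whiskerLeftIso (lu' (M.hom s x) ≫ wr (ru' (𝕀 C)) _ ≫ wr (wr g (𝕀 C)) (M.hom s x) ≫
      wr (wl (M.hom y z) f) (M.hom s x))
    (M.pi s x y z) ≪≫
  eqToIso (by
    simp only [post, wl_comp, wl_eqToHom, wr_eqToHom, wr_wl_assoc, wr_wr_assoc, Strict.assoc,
      eqToHom_trans_assoc]
    rw [← eqToHom_trans_assoc (unit_tensor (M.hom s x)).symm
      (congrArg (fun X => 𝕀 C ⊡ X) (unit_tensor (M.hom s x)).symm),
      ← wr_eqToHom_right g (unit_tensor (M.hom s x)).symm]) ≪≫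
  whiskerLeftIso (lu' (M.hom s x)) (whiskerRightIso (inter g (post f s)).symm (M.m s y z)) ≪≫
  eqToIso (by simp only [post, Strict.assoc, lu'_wl])

/-- The canonical interchanger `g_* ∘ f^* ≅ f^* ∘ g_*` of enriched hom 2-functors, given by the
interchanger of `C` and the inverse enriched associator. -/
def exch (f : M.Mor x y) (g : M.Mor z t) :
    pre f z ≫ post g x ≅ post g y ≫ pre f t :=
  eqToIso (by simp only [pre, post, Strict.assoc, lu'_wl]) ≪≫
  whiskerLeftIso (ru' (M.hom y z) ≫ wl (M.hom y z) f ≫ lu' _)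
    (whiskerRightIso (inter g (M.m x y z)) (M.m x z t)) ≪≫
  eqToIso (by
    simp only [Strict.assoc, wr_wr_assoc, eqToHom_trans_assoc]) ≪≫
  whiskerLeftIso (ru' (M.hom y z) ≫ wl (M.hom y z) f ≫ lu' _ ≫
      as' (𝕀 C) (M.hom y z) (M.hom x y) ≫ wr (wr g (M.hom y z)) (M.hom x y))
    (M.pi x y z t).symm ≪≫
  eqToIso (by
    simp only [post, wr_comp, wr_eqToHom, Strict.assoc, eqToHom_trans_assoc]) ≪≫
  whiskerLeftIso (ru' (M.hom y z)) (whiskerRightIso (inter (post g y) f) (M.m x y t)) ≪≫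
  eqToIso (by simp only [pre, Strict.assoc, ru'_wr])

/-- The associator `(h ∘ g) ∘ f ≅ h ∘ (g ∘ f)` of the underlying 2-category. -/
def assocMor (f : M.Mor x y) (g : M.Mor y z) (h : M.Mor z t) :
    compMor f (compMor g h) ≅ compMor (compMor f g) h :=
  eqToIso (by simp only [compMor_eq, Strict.assoc]) ≪≫
  whiskerLeftIso h (preComp f g t).symm ≪≫
  eqToIso (compMor_eq _ _).symm

end EnrichedBicategory

/-! ### 2-fiber products -/

section FiberProduct

variable {C : Type u} [Bicategory.{w, v} C]

/-- A 2-fiber product of the cospan `X --f--> Z <--g-- Y`. -/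
structure TwoFiberProduct {X Y Z : C} (f : X ⟶ Z) (g : Y ⟶ Z) where
  pt : C
  fst : pt ⟶ X
  snd : pt ⟶ Y
  cell : fst ≫ f ≅ snd ≫ g
  exists_lift {A : C} (p : A ⟶ X) (q : A ⟶ Y) (ξ : p ≫ f ≅ q ≫ g) :
    ∃ (k : A ⟶ pt) (ζ₁ : k ≫ fst ≅ p) (ζ₂ : k ≫ snd ≅ q),
      ζ₁.hom ▷ f ≫ ξ.hom =
        (α_ k fst f).hom ≫ k ◁ cell.hom ≫ (α_ k snd g).inv ≫ ζ₂.hom ▷ g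
  existsUnique_cell {A : C} (k l : A ⟶ pt) (γ₁ : k ≫ fst ⟶ l ≫ fst) (γ₂ : k ≫ snd ⟶ l ≫ snd) :
    γ₁ ▷ f ≫ (α_ l fst f).hom ≫ l ◁ cell.hom ≫ (α_ l snd g).inv =
      (α_ k fst f).hom ≫ k ◁ cell.hom ≫ (α_ k snd g).inv ≫ γ₂ ▷ g →
    ∃! θ : k ⟶ l, θ ▷ fst = γ₁ ∧ θ ▷ snd = γ₂

/-- A 1-morphism into the 2-fiber product `P` induced by the 2-universal property from the square
`ξ`, together with its two structure 2-isomorphisms. -/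
structure Lift {X Y Z : C} {f : X ⟶ Z} {g : Y ⟶ Z} (P : TwoFiberProduct f g) {A : C}
    (p : A ⟶ X) (q : A ⟶ Y) (ξ : p ≫ f ≅ q ≫ g) where
  hom : A ⟶ P.pt
  fstIso : hom ≫ P.fst ≅ p
  sndIso : hom ≫ P.snd ≅ q
  comm : fstIso.hom ▷ f ≫ ξ.hom =
    (α_ hom P.fst f).hom ≫ hom ◁ P.cell.hom ≫ (α_ hom P.snd g).inv ≫ sndIso.hom ▷ g

instance {X Y Z : C} {f : X ⟶ Z} {g : Y ⟶ Z} (P : TwoFiberProduct f g) {A : C}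
    (p : A ⟶ X) (q : A ⟶ Y) (ξ : p ≫ f ≅ q ≫ g) : Nonempty (Lift P p q ξ) :=
  let ⟨k, ζ₁, ζ₂, h⟩ := P.exists_lift p q ξ
  ⟨⟨k, ζ₁, ζ₂, h⟩⟩

end FiberProduct

/-! ### The laxators -/

section Laxator

open EnrichedBicategory

variable {C : Type u} [Bicategory.{w, v} C] [Bicategory.Strict C] [GrayMonoid C]
variable {M : EnrichedBicategory.{w, v, u, u'} C} {x y z t : M.Obj}

/-- A choice of the object `A_f` for a 1-morphism `f : x ⟶ y`: a 2-fiber product of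
`M[x, x] --f_*--> M[x, y] <--f^*-- M[y, y]`.  Its projections `fst`, `snd` are `p_x`, `p_y`. -/
abbrev FiberAlg (f : M.Mor x y) := TwoFiberProduct (post f x) (pre f y)

/-- The pasting, over a 2-fiber product `P` of `p_y : A_f ⟶ M[y, y] ⟵ A_g : p_y`, of the 2-cells of
`A_f`, `P`, `A_g` and the interchanger between `f` and `g`. -/
def laxatorCell {f : M.Mor x y} {g : M.Mor y z} (Af : FiberAlg f) (Ag : FiberAlg g)
    (P : TwoFiberProduct Af.snd Ag.fst) :
    (P.fst ≫ Af.fst) ≫ post (compMor f g) x ≅ (P.snd ≫ Ag.snd) ≫ pre (compMor f g) z :=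
  whiskerLeftIso (P.fst ≫ Af.fst) (postComp f g x) ≪≫
  eqToIso (by simp only [Strict.assoc]) ≪≫
  whiskerLeftIso P.fst (whiskerRightIso Af.cell (post g x)) ≪≫
  eqToIso (by simp only [Strict.assoc]) ≪≫
  whiskerRightIso P.cell (pre f y ≫ post g x) ≪≫
  eqToIso (by simp only [Strict.assoc]) ≪≫
  whiskerLeftIso (P.snd ≫ Ag.fst) (exch f g) ≪≫
  eqToIso (by simp only [Strict.assoc]) ≪≫
  whiskerLeftIso P.snd (whiskerRightIso Ag.cell (pre f z)) ≪≫
  eqToIso (by simp only [Strict.assoc]) ≪≫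
  whiskerLeftIso (P.snd ≫ Ag.snd) (preComp f g z).symm

/-- The laxator `Φ_{f,g} : A_f ×_{A_y} A_g ⟶ A_{g ∘ f}`, induced by the 2-universal property of
`A_{g ∘ f}`. -/
abbrev Laxator {f : M.Mor x y} {g : M.Mor y z} (Af : FiberAlg f) (Ag : FiberAlg g)
    (P : TwoFiberProduct Af.snd Ag.fst) (Agf : FiberAlg (compMor f g)) :=
  Lift Agf (P.fst ≫ Af.fst) (P.snd ≫ Ag.snd) (laxatorCell Af Ag P)

/-- The comparison `A_f ⟶ A_{f'}` along an invertible 2-morphism `a : f ≅ f'`. -/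
abbrev Reindex {f f' : M.Mor x y} (a : f ≅ f') (Af : FiberAlg f) (Af' : FiberAlg f') :=
  Lift Af' Af.fst Af.snd
    (whiskerLeftIso Af.fst (postIso a x).symm ≪≫ Af.cell ≪≫ whiskerLeftIso Af.snd (preIso a y))

section Triple

variable {f : M.Mor x y} {g : M.Mor y z} {h : M.Mor z t}
  {Af : FiberAlg f} {Ag : FiberAlg g} {Ah : FiberAlg h}
  {Pfg : TwoFiberProduct Af.snd Ag.fst} {Pgh : TwoFiberProduct Ag.snd Ah.fst}
  {Agf : FiberAlg (compMor f g)} {Ahg : FiberAlg (compMor g h)}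

/-- A triple 2-fiber product `A_f ×_{A_y} A_g ×_{A_z} A_h`: a 2-fiber product of the projections
`A_f ×_{A_y} A_g ⟶ A_g ⟵ A_g ×_{A_z} A_h`. -/
abbrev TripleFiberProduct (Pfg : TwoFiberProduct Af.snd Ag.fst)
    (Pgh : TwoFiberProduct Ag.snd Ah.fst) := TwoFiberProduct Pfg.snd Pgh.fst

/-- The square over the triple 2-fiber product inducing `Φ_{f,g} ×_{A_z} 1`. -/
def whiskerRightCell (Φ : Laxator Af Ag Pfg Agf) (T : TripleFiberProduct Pfg Pgh) :
    (T.fst ≫ Φ.hom) ≫ Agf.snd ≅ (T.snd ≫ Pgh.snd) ≫ Ah.fst :=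
  α_ _ _ _ ≪≫ whiskerLeftIso T.fst Φ.sndIso ≪≫ (α_ _ _ _).symm ≪≫
    whiskerRightIso T.cell Ag.snd ≪≫ α_ _ _ _ ≪≫ whiskerLeftIso T.snd Pgh.cell ≪≫ (α_ _ _ _).symm

/-- The 1-morphism `Φ_{f,g} ×_{A_z} 1 : A_f ×_{A_y} A_g ×_{A_z} A_h ⟶ A_{g ∘ f} ×_{A_z} A_h`. -/
abbrev LaxatorProdId (Φ : Laxator Af Ag Pfg Agf) (T : TripleFiberProduct Pfg Pgh)
    (Q : TwoFiberProduct Agf.snd Ah.fst) :=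
  Lift Q (T.fst ≫ Φ.hom) (T.snd ≫ Pgh.snd) (whiskerRightCell Φ T)

/-- The square over the triple 2-fiber product inducing `1 ×_{A_y} Φ_{g,h}`. -/
def whiskerLeftCell (Ψ : Laxator Ag Ah Pgh Ahg) (T : TripleFiberProduct Pfg Pgh) :
    (T.fst ≫ Pfg.fst) ≫ Af.snd ≅ (T.snd ≫ Ψ.hom) ≫ Ahg.fst :=
  α_ _ _ _ ≪≫ whiskerLeftIso T.fst Pfg.cell ≪≫ (α_ _ _ _).symm ≪≫
    whiskerRightIso T.cell Ag.fst ≪≫ α_ _ _ _ ≪≫ whiskerLeftIso T.snd Ψ.fstIso.symm ≪≫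
    (α_ _ _ _).symm

/-- The 1-morphism `1 ×_{A_y} Φ_{g,h} : A_f ×_{A_y} A_g ×_{A_z} A_h ⟶ A_f ×_{A_y} A_{h ∘ g}`. -/
abbrev IdProdLaxator (Ψ : Laxator Ag Ah Pgh Ahg) (T : TripleFiberProduct Pfg Pgh)
    (R : TwoFiberProduct Af.snd Ahg.fst) :=
  Lift R (T.fst ≫ Pfg.fst) (T.snd ≫ Ψ.hom) (whiskerLeftCell Ψ T)

variable {T : TripleFiberProduct Pfg Pgh}
  {Q : TwoFiberProduct Agf.snd Ah.fst} {R : TwoFiberProduct Af.snd Ahg.fst}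
  {Ahgf : FiberAlg (compMor (compMor f g) h)} {Ahgf' : FiberAlg (compMor f (compMor g h))}
  {Φ : Laxator Af Ag Pfg Agf} {Ψ : Laxator Ag Ah Pgh Ahg}

/-- The composite of `Φ_{f,g} ×_{A_z} 1` and `Φ_{gf,h}` commutes with the projections to
`A_x = M[x, x]`. -/
def leftFstIso (L : LaxatorProdId Φ T Q) (Φ' : Laxator Agf Ah Q Ahgf) :
    (L.hom ≫ Φ'.hom) ≫ Ahgf.fst ≅ (T.fst ≫ Pfg.fst) ≫ Af.fst :=
  α_ _ _ _ ≪≫ whiskerLeftIso L.hom Φ'.fstIso ≪≫ (α_ _ _ _).symm ≪≫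
    whiskerRightIso L.fstIso Agf.fst ≪≫ α_ _ _ _ ≪≫ whiskerLeftIso T.fst Φ.fstIso ≪≫
    (α_ _ _ _).symm

/-- The same for the projections to `M[t, t]`, where `t` is the target of `h`. -/
def leftSndIso (L : LaxatorProdId Φ T Q) (Φ' : Laxator Agf Ah Q Ahgf) :
    (L.hom ≫ Φ'.hom) ≫ Ahgf.snd ≅ (T.snd ≫ Pgh.snd) ≫ Ah.snd :=
  α_ _ _ _ ≪≫ whiskerLeftIso L.hom Φ'.sndIso ≪≫ (α_ _ _ _).symm ≪≫
    whiskerRightIso L.sndIso Ah.snd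

/-- The composite of `1 ×_{A_y} Φ_{g,h}`, `Φ_{f,hg}` and the comparison `A_{(hg)f} ⟶ A_{h(gf)}`
commutes with the projections to `A_x = M[x, x]`. -/
def rightFstIso (L : IdProdLaxator Ψ T R) (Ψ' : Laxator Af Ahg R Ahgf')
    (K : Reindex (assocMor f g h) Ahgf' Ahgf) :
    (L.hom ≫ Ψ'.hom ≫ K.hom) ≫ Ahgf.fst ≅ (T.fst ≫ Pfg.fst) ≫ Af.fst :=
  α_ _ _ _ ≪≫ whiskerLeftIso L.hom (α_ _ _ _ ≪≫ whiskerLeftIso Ψ'.hom K.fstIso ≪≫ Ψ'.fstIso) ≪≫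
    (α_ _ _ _).symm ≪≫ whiskerRightIso L.fstIso Af.fst

/-- The same for the projections to `M[t, t]`, where `t` is the target of `h`. -/
def rightSndIso (L : IdProdLaxator Ψ T R) (Ψ' : Laxator Af Ahg R Ahgf')
    (K : Reindex (assocMor f g h) Ahgf' Ahgf) :
    (L.hom ≫ Ψ'.hom ≫ K.hom) ≫ Ahgf.snd ≅ (T.snd ≫ Pgh.snd) ≫ Ah.snd :=
  α_ _ _ _ ≪≫ whiskerLeftIso L.hom (α_ _ _ _ ≪≫ whiskerLeftIso Ψ'.hom K.sndIso ≪≫ Ψ'.sndIso) ≪≫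
    (α_ _ _ _).symm ≪≫ whiskerRightIso L.sndIso Ahg.snd ≪≫ α_ _ _ _ ≪≫
    whiskerLeftIso T.snd Ψ.sndIso ≪≫ (α_ _ _ _).symm

end Triple

end Laxator

end LaxSpan

open LaxSpan LaxSpan.EnrichedBicategory

/-! A 2-cell between 1-morphisms into a 2-fiber product is a pair of 2-cells between their
projections that is compatible with the universal square. So it suffices that both composites of
laxators, with their structure isomorphisms, are lifts of one and the same square over `T`. The
structure isomorphisms of one, followed by the inverses of those of the other, then form a
compatible pair, and `TwoFiberProduct.existsUnique_iso_of_comm` gives the unique invertible 2-cell.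

Unwinding the universal properties shows that the two composites are lifts of `leftPasting`
(`left_comm`) and of `rightPasting` (`right_comm`). These pastings contain the same six fiber
product cells and differ in the coherence cells of push-forwards and pullbacks. Once the latter are
slid past the fiber product cells by the interchange law, the equality `leftPasting_eq_rightPasting`
reduces to four equations: `postComp_assoc`, `exch_compMor_post`, `exch_compMor_pre` and
`preComp_assoc`.

All four are the pentagon of `M` with three of its four entries fixed and one left free: `(h, g, f,
-)`, `(h, g, -, f)`, `(h, -, g, f)` and `(-, h, g, f)`. Fixing the last entry gives `preAct_act`;
fixing the third one as well gives `preAct_compMor`. Inserting an entry commutes with other 1-cells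
only up to the interchanger, and the Gray monoid axioms account for the extra cells. -/

namespace LaxSpan

/-! ### A calculus of invertible 2-cells in which strict equalities are equalities -/

/-- An invertible 2-cell of a bicategory, bundled with its boundary. -/
structure ICell {C : Type u} [Bicategory.{w, v} C] (A B : C) where
  src : A ⟶ B
  tgt : A ⟶ B
  iso : src ≅ tgt

namespace ICell

section Basic

variable {C : Type u} [Bicategory.{w, v} C]

/-- The bundled form of an invertible 2-cell. -/
def of {A B : C} {f g : A ⟶ B} (η : f ≅ g) : ICell A B := ⟨f, g, η⟩

/-- The identity cell of a 1-cell. -/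
def id {A B : C} (f : A ⟶ B) : ICell A B := of (Iso.refl f)

/-- Vertical composition. -/
def comp {A B : C} (a b : ICell A B) (h : a.tgt = b.src) : ICell A B :=
  of (a.iso ≪≫ eqToIso h ≪≫ b.iso)

/-- The inverse cell. -/
def symm {A B : C} (a : ICell A B) : ICell A B := of a.iso.symm

/-- Left whiskering. -/
def lw {A B D : C} (f : A ⟶ B) (a : ICell B D) : ICell A D := of (whiskerLeftIso f a.iso)

/-- Right whiskering. -/
def rw {A B D : C} (a : ICell A B) (f : B ⟶ D) : ICell A D := of (whiskerRightIso a.iso f)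

variable {A B D E : C}

@[simp] theorem of_src {f g : A ⟶ B} (η : f ≅ g) : (of η).src = f := by exact Eq.refl _
@[simp] theorem of_tgt {f g : A ⟶ B} (η : f ≅ g) : (of η).tgt = g := by exact Eq.refl _
@[simp] theorem comp_src (a b : ICell A B) (h : a.tgt = b.src) : (comp a b h).src = a.src := by
  exact Eq.refl _
@[simp] theorem comp_tgt (a b : ICell A B) (h : a.tgt = b.src) : (comp a b h).tgt = b.tgt := by
  exact Eq.refl _
@[simp] theorem symm_src (a : ICell A B) : a.symm.src = a.tgt := by exact Eq.refl _
@[simp] theorem symm_tgt (a : ICell A B) : a.symm.tgt = a.src := by exact Eq.refl _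
@[simp] theorem lw_src (f : A ⟶ B) (a : ICell B D) : (lw f a).src = f ≫ a.src := by exact Eq.refl _
@[simp] theorem lw_tgt (f : A ⟶ B) (a : ICell B D) : (lw f a).tgt = f ≫ a.tgt := by exact Eq.refl _
@[simp] theorem rw_src (a : ICell A B) (f : B ⟶ D) : (rw a f).src = a.src ≫ f := by exact Eq.refl _
@[simp] theorem rw_tgt (a : ICell A B) (f : B ⟶ D) : (rw a f).tgt = a.tgt ≫ f := by exact Eq.refl _

theorem of_injective {f g : A ⟶ B} {η θ : f ≅ g} (h : of η = of θ) : η = θ := by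
  simpa [of] using h

/-- The bridge to axioms stated with `eqToHom`: such an axiom becomes a plain equality of bundled
cells, since the boundaries can be substituted. -/
theorem ext_hom {a b : ICell A B} (hs : a.src = b.src) (ht : a.tgt = b.tgt)
    (h : a.iso.hom = eqToHom hs ≫ b.iso.hom ≫ eqToHom ht.symm) : a = b := by
  obtain ⟨s, t, i⟩ := a
  obtain ⟨s', t', i'⟩ := b
  dsimp only at hs ht
  subst hs ht
  have : i = i' := by ext; simpa using h
  rw [this]

@[simp] theorem of_trans {f g h : A ⟶ B} (η : f ≅ g) (θ : g ≅ h) :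
    of (η ≪≫ θ) = comp (of η) (of θ) (by simp) := by
  change _ = of (η ≪≫ eqToIso (rfl : g = g) ≪≫ θ)
  simp

@[simp] theorem of_symm {f g : A ⟶ B} (η : f ≅ g) : of η.symm = (of η).symm := by
  exact Eq.refl _

@[simp] theorem of_whiskerLeftIso (f : A ⟶ B) {g h : B ⟶ D} (η : g ≅ h) :
    of (whiskerLeftIso f η) = lw f (of η) := by
  exact Eq.refl _

@[simp] theorem of_whiskerRightIso {g h : A ⟶ B} (η : g ≅ h) (f : B ⟶ D) :
    of (whiskerRightIso η f) = rw (of η) f := by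
  exact Eq.refl _

@[simp] theorem of_refl (f : A ⟶ B) : of (Iso.refl f) = id f := by
  exact Eq.refl _

-- The reason for bundling: transports along equalities of 1-cells become identity cells, which
-- `id_comp` and `comp_id` then delete.
@[simp] theorem of_eqToIso {f g : A ⟶ B} (h : f = g) : of (eqToIso h) = id f := by
  subst h; rfl

@[simp] theorem id_comp (f : A ⟶ B) (a : ICell A B) (h : (id f).tgt = a.src) :
    comp (id f) a h = a := by
  obtain ⟨s, t, i⟩ := a
  obtain rfl : f = s := h
  change of (Iso.refl f ≪≫ eqToIso (rfl : f = f) ≪≫ i) = of i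
  simp

@[simp] theorem comp_id (f : A ⟶ B) (a : ICell A B) (h : a.tgt = (id f).src) :
    comp a (id f) h = a := by
  obtain ⟨s, t, i⟩ := a
  obtain rfl : t = f := h
  change of (i ≪≫ eqToIso (rfl : t = t) ≪≫ Iso.refl t) = of i
  simp

@[simp] theorem comp_assoc (a b c : ICell A B) (h : a.tgt = b.src)
    (h' : (comp a b h).tgt = c.src) :
    comp (comp a b h) c h' = comp a (comp b c (by simpa using h')) (by simpa using h) := by
  simp [comp, of]

@[simp] theorem symm_symm (a : ICell A B) : a.symm.symm = a := by
  exact Eq.refl _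

@[simp] theorem symm_id (f : A ⟶ B) : (id f).symm = id f := by
  exact Eq.refl _

@[simp] theorem symm_comp (a b : ICell A B) (h : a.tgt = b.src) :
    (comp a b h).symm = comp b.symm a.symm h.symm := by
  obtain ⟨s, t, i⟩ := a
  obtain ⟨s', t', i'⟩ := b
  cases h
  simp [comp, of, symm]

@[simp] theorem symm_lw (f : A ⟶ B) (a : ICell B D) : (lw f a).symm = lw f a.symm := by
  exact Eq.refl _

@[simp] theorem symm_rw (a : ICell A B) (f : B ⟶ D) : (rw a f).symm = rw a.symm f := by
  exact Eq.refl _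

@[simp] theorem comp_symm (a : ICell A B) (h : a.tgt = a.symm.src) :
    comp a a.symm h = id a.src := by
  change of (a.iso ≪≫ eqToIso (rfl : a.tgt = a.tgt) ≪≫ a.iso.symm) = of (Iso.refl _)
  simp

@[simp] theorem symm_comp_self (a : ICell A B) (h : a.symm.tgt = a.src) :
    comp a.symm a h = id a.tgt := by
  change of (a.iso.symm ≪≫ eqToIso (rfl : a.src = a.src) ≪≫ a.iso) = of (Iso.refl _)
  simp

@[simp] theorem comp_symm_assoc (a b : ICell A B) (h : a.symm.tgt = b.src)
    (h' : a.tgt = (comp a.symm b h).src) : comp a (comp a.symm b h) h' = b := by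
  simp only [← comp_assoc a a.symm b (by simp) h, comp_symm, id_comp]

@[simp] theorem symm_comp_assoc (a b : ICell A B) (h : a.tgt = b.src)
    (h' : a.symm.tgt = (comp a b h).src) : comp a.symm (comp a b h) h' = b := by
  simp only [← comp_assoc a.symm a b (by simp) h, symm_comp_self, id_comp]

@[simp] theorem lw_id (f : A ⟶ B) (g : B ⟶ D) : lw f (id g) = id (f ≫ g) :=
  congrArg of (by ext; exact whiskerLeft_id f g)

@[simp] theorem rw_id (f : A ⟶ B) (g : B ⟶ D) : rw (id f) g = id (f ≫ g) :=
  congrArg of (by ext; exact id_whiskerRight f g)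

@[simp] theorem lw_comp (f : A ⟶ B) (a b : ICell B D) (h : a.tgt = b.src) :
    lw f (comp a b h) = comp (lw f a) (lw f b) (by simp [h]) := by
  obtain ⟨s, t, i⟩ := a
  obtain ⟨s', t', i'⟩ := b
  cases h
  change of (whiskerLeftIso f (i ≪≫ eqToIso (rfl : t = t) ≪≫ i')) =
    of (whiskerLeftIso f i ≪≫ eqToIso (rfl : f ≫ t = f ≫ t) ≪≫ whiskerLeftIso f i')
  refine congrArg of ?_
  ext
  simp

@[simp] theorem rw_comp (a b : ICell A B) (h : a.tgt = b.src) (f : B ⟶ D) :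
    rw (comp a b h) f = comp (rw a f) (rw b f) (by simp [h]) := by
  obtain ⟨s, t, i⟩ := a
  obtain ⟨s', t', i'⟩ := b
  cases h
  change of (whiskerRightIso (i ≪≫ eqToIso (rfl : t = t) ≪≫ i') f) =
    of (whiskerRightIso i f ≪≫ eqToIso (rfl : t ≫ f = t ≫ f) ≪≫ whiskerRightIso i' f)
  refine congrArg of ?_
  ext
  simp

/-- Whiskerings on the two sides commute. -/
theorem exchange (a : ICell A B) (b : ICell B D) :
    comp (rw a b.src) (lw a.tgt b) (by simp) = comp (lw a.src b) (rw a b.tgt) (by simp) := by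
  obtain ⟨s, t, i⟩ := a
  obtain ⟨s', t', i'⟩ := b
  change of (whiskerRightIso i s' ≪≫ eqToIso (rfl : t ≫ s' = t ≫ s') ≪≫ whiskerLeftIso t i') =
    of (whiskerLeftIso s i' ≪≫ eqToIso (rfl : s ≫ t' = s ≫ t') ≪≫ whiskerRightIso i t')
  refine congrArg of ?_
  ext
  simp [whisker_exchange]

theorem tgt_eq_of_comp_eq {a b c d : ICell A B} {h : a.tgt = b.src} {h' : c.tgt = d.src}
    (H : comp a b h = comp c d h') : d.tgt = b.tgt := by
  simpa using (congrArg tgt H).symm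

/-- Rewriting the first two factors of a composite. -/
theorem comp_comp_congr {a b c d e : ICell A B} {h : a.tgt = b.src} {h' : c.tgt = d.src}
    (H : comp a b h = comp c d h') (he : b.tgt = e.src) :
    comp a (comp b e he) (by simpa using h) =
      comp c (comp d e (by rw [tgt_eq_of_comp_eq H, he])) (by simpa using h') := by
  rw [← comp_assoc a b e h (by simpa using he)]
  simp only [H, comp_assoc]

/-- Rewriting the first three factors of a composite. -/
theorem comp_comp_comp_congr {a b c a' b' c' e : ICell A B} {h₁ : b.tgt = c.src}
    {h₂ : a.tgt = (comp b c h₁).src} {h₁' : b'.tgt = c'.src} {h₂' : a'.tgt = (comp b' c' h₁').src}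
    (H : comp a (comp b c h₁) h₂ = comp a' (comp b' c' h₁') h₂') (he : c.tgt = e.src) :
    comp a (comp b (comp c e he) (by simpa using h₁)) (by simpa using h₂) =
      comp a' (comp b' (comp c' e (by simpa [he] using tgt_eq_of_comp_eq H)) (by simpa using h₁'))
        (by simpa using h₂') := by
  have := comp_comp_congr (e := e) H (by simpa using he)
  simpa using this

theorem eq_comp_symm {a b c : ICell A B} {h : a.tgt = b.src} (e : comp a b h = c) :
    a = comp c b.symm (by simp [← e]) := by
  subst e; simp

theorem eq_symm_comp {a b c : ICell A B} {h : a.tgt = b.src} (e : comp a b h = c) :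
    b = comp a.symm c (by simp [← e]) := by
  subst e; simp

/-- Moving the outer factors of an equation between composites of length three. -/
theorem comp_rotate {a b c a' b' c' : ICell A B} {h₁ : b.tgt = c.src}
    {h₂ : a.tgt = (comp b c h₁).src} {h₁' : b'.tgt = c'.src} {h₂' : a'.tgt = (comp b' c' h₁').src}
    (H : comp a (comp b c h₁) h₂ = comp a' (comp b' c' h₁') h₂') :
    comp c' (comp c.symm b.symm (by simp [h₁]))
        (by simpa using (tgt_eq_of_comp_eq H)) =
      comp b'.symm (comp a'.symm a (by simpa using (congrArg src H).symm))
        (by simpa using h₂'.symm) := by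
  have e1 := eq_symm_comp (eq_symm_comp H.symm)
  simp [e1]

theorem comp_rotate' {a b c a' b' c' : ICell A B} {h₁ : b.tgt = c.src}
    {h₂ : a.tgt = (comp b c h₁).src} {h₁' : b'.tgt = c'.src} {h₂' : a'.tgt = (comp b' c' h₁').src}
    (H : comp a (comp b c h₁) h₂ = comp a' (comp b' c' h₁') h₂') :
    comp b (comp c c'.symm (by simpa using (tgt_eq_of_comp_eq H).symm)) (by simpa using h₁) =
      comp a.symm (comp a' b' (by simpa using h₂')) (by simpa using congrArg src H) := by
  have e1 := eq_symm_comp H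
  have e2 := eq_comp_symm (a := comp a.symm (comp a' b' (by simpa using h₂'))
    (by simpa using congrArg src H)) (b := c') (h := by simpa using h₁') rfl
  rw [e2]
  simp only [comp_assoc, ← e1]

theorem comp_rotate'' {a b c a' b' c' : ICell A B} {h₁ : b.tgt = c.src}
    {h₂ : a.tgt = (comp b c h₁).src} {h₁' : b'.tgt = c'.src} {h₂' : a'.tgt = (comp b' c' h₁').src}
    (H : comp a (comp b c h₁) h₂ = comp a' (comp b' c' h₁') h₂') :
    comp a'.symm (comp a b (by simpa using h₂)) (by simpa using (congrArg src H).symm) =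
      comp b' (comp c' c.symm (by simpa using (tgt_eq_of_comp_eq H))) (by simpa using h₁') := by
  exact (comp_rotate' H.symm).symm

theorem comp_square {a b c d : ICell A B} {h : a.tgt = b.src} {h' : c.tgt = d.src}
    (H : comp a b h = comp c d h') :
    comp c.symm a (by simpa using (congrArg src H).symm) =
      comp d b.symm (by simpa using tgt_eq_of_comp_eq H) := by
  have e1 := eq_symm_comp H.symm
  simp [e1]

end Basic

/-! ### Normal forms for whiskered cells in a strict 2-category. -/

section Strict

variable {C : Type u} [Bicategory.{w, v} C] [Bicategory.Strict C] {A B D E : C}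

@[simp] theorem of_associator (f : A ⟶ B) (g : B ⟶ D) (h : D ⟶ E) :
    of (α_ f g h) = id (f ≫ g ≫ h) := by
  rw [Strict.associator_eqToIso, of_eqToIso, Strict.assoc]

-- Associators are identities here. As rewriting rules, this, `rw_rw` and `rw_lw` bring every
-- iterated whiskering to the form `lw f (rw a g)`, so that equal pastings become comparable factor
-- by factor.
@[simp] theorem lw_lw (f : A ⟶ B) (g : B ⟶ D) (a : ICell D E) :
    lw f (lw g a) = lw (f ≫ g) a := by
  refine ext_hom (Strict.assoc _ _ _).symm (Strict.assoc _ _ _).symm ?_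
  have e : f ◁ g ◁ a.iso.hom =
      eqToHom (by simp) ≫ ((f ≫ g) ◁ a.iso.hom) ≫ eqToHom (by simp) := by
    simp [Strict.associator_eqToIso]
  exact e

@[simp] theorem rw_rw (a : ICell A B) (f : B ⟶ D) (g : D ⟶ E) :
    rw (rw a f) g = rw a (f ≫ g) := by
  refine ext_hom (Strict.assoc _ _ _) (Strict.assoc _ _ _) ?_
  have e : (a.iso.hom ▷ f) ▷ g =
      eqToHom (by simp) ≫ (a.iso.hom ▷ (f ≫ g)) ≫ eqToHom (by simp) := by
    simp [Strict.associator_eqToIso]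
  exact e

@[simp] theorem rw_lw (f : A ⟶ B) (a : ICell B D) (g : D ⟶ E) :
    rw (lw f a) g = lw f (rw a g) := by
  refine ext_hom (Strict.assoc _ _ _) (Strict.assoc _ _ _) ?_
  have e : (f ◁ a.iso.hom) ▷ g =
      eqToHom (by simp) ≫ (f ◁ (a.iso.hom ▷ g)) ≫ eqToHom (by simp) := by
    simp [Strict.associator_eqToIso]
  exact e

@[simp] theorem id_lw (a : ICell A B) : lw (𝟙 A) a = a := by
  refine ext_hom (Strict.id_comp _) (Strict.id_comp _) ?_
  have e : 𝟙 A ◁ a.iso.hom =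
      eqToHom (Strict.id_comp _) ≫ a.iso.hom ≫ eqToHom (Strict.id_comp _).symm := by
    simp [Strict.leftUnitor_eqToIso]
  exact e

@[simp] theorem rw_id_one (a : ICell A B) : rw a (𝟙 B) = a := by
  refine ext_hom (Strict.comp_id _) (Strict.comp_id _) ?_
  have e : a.iso.hom ▷ 𝟙 B =
      eqToHom (Strict.comp_id _) ≫ a.iso.hom ≫ eqToHom (Strict.comp_id _).symm := by
    simp [Strict.rightUnitor_eqToIso]
  exact e

end Strict
end ICell
end LaxSpan

/-! ### The Gray product and its interchanger on bundled cells. -/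

namespace LaxSpan

open GrayMonoid

attribute [simp] wl_id wl_comp wr_id wr_comp wr_wr wr_wl wl_wl wr_wr_assoc wr_wl_assoc wl_wl_assoc

namespace ICell

variable {C : Type u} [Bicategory.{w, v} C] [Bicategory.Strict C] [GrayMonoid C]
variable {A A' A'' B B' B'' D D' : C}

/-- `A ⊡ -` on invertible 2-cells. -/
def wlc (A : C) (a : ICell B B') : ICell (A ⊡ B) (A ⊡ B') := of (wlIso A a.iso)

/-- `- ⊡ B` on invertible 2-cells. -/
def wrc (a : ICell A A') (B : C) : ICell (A ⊡ B) (A' ⊡ B) := of (wrIso a.iso B)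

/-- The interchanger. -/
def intc (f : A ⟶ A') (g : B ⟶ B') : ICell (A ⊡ B) (A' ⊡ B') := of (inter f g)

@[simp] theorem wlc_src (a : ICell B B') : (wlc A a).src = wl A a.src := by exact Eq.refl _
@[simp] theorem wlc_tgt (a : ICell B B') : (wlc A a).tgt = wl A a.tgt := by exact Eq.refl _
@[simp] theorem wrc_src (a : ICell A A') : (wrc a B).src = wr a.src B := by exact Eq.refl _
@[simp] theorem wrc_tgt (a : ICell A A') : (wrc a B).tgt = wr a.tgt B := by exact Eq.refl _
@[simp] theorem intc_src (f : A ⟶ A') (g : B ⟶ B') : (intc f g).src = wl A g ≫ wr f B' := by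
  exact Eq.refl _
@[simp] theorem intc_tgt (f : A ⟶ A') (g : B ⟶ B') : (intc f g).tgt = wr f B ≫ wl A' g := by
  exact Eq.refl _

@[simp] theorem of_wlIso {g g' : B ⟶ B'} (θ : g ≅ g') : of (wlIso A θ) = wlc A (of θ) := rfl
@[simp] theorem of_wrIso {f f' : A ⟶ A'} (η : f ≅ f') : of (wrIso η B) = wrc (of η) B := rfl
@[simp] theorem of_inter (f : A ⟶ A') (g : B ⟶ B') : of (inter f g) = intc f g := rfl

@[simp] theorem wlc_symm (a : ICell B B') : (wlc A a).symm = wlc A a.symm := rfl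
@[simp] theorem wrc_symm (a : ICell A A') : (wrc a B).symm = wrc a.symm B := rfl

@[simp] theorem wlc_comp (a b : ICell B B') (h : a.tgt = b.src) :
    wlc A (comp a b h) = comp (wlc A a) (wlc A b) (by simp [h]) := by
  obtain ⟨s, t, i⟩ := a
  obtain ⟨s', t', i'⟩ := b
  cases h
  change of (wlIso A (i ≪≫ eqToIso (rfl : t = t) ≪≫ i')) =
    of (wlIso A i ≪≫ eqToIso (rfl : wl A t = wl A t) ≪≫ wlIso A i')
  refine congrArg of ?_
  ext
  simp [wl₂_comp]

@[simp] theorem wrc_comp (a b : ICell A A') (h : a.tgt = b.src) :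
    wrc (comp a b h) B = comp (wrc a B) (wrc b B) (by simp [h]) := by
  obtain ⟨s, t, i⟩ := a
  obtain ⟨s', t', i'⟩ := b
  cases h
  change of (wrIso (i ≪≫ eqToIso (rfl : t = t) ≪≫ i') B) =
    of (wrIso i B ≪≫ eqToIso (rfl : wr t B = wr t B) ≪≫ wrIso i' B)
  refine congrArg of ?_
  ext
  simp [wr₂_comp]

@[simp] theorem wlc_lw (g : B ⟶ B') (a : ICell B' B'') :
    wlc A (lw g a) = lw (wl A g) (wlc A a) :=
  ext_hom (wl_comp _ _ _) (wl_comp _ _ _) (wl₂_whiskerLeft A g a.iso.hom)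

@[simp] theorem wlc_rw (a : ICell B B') (g : B' ⟶ B'') :
    wlc A (rw a g) = rw (wlc A a) (wl A g) :=
  ext_hom (wl_comp _ _ _) (wl_comp _ _ _) (wl₂_whiskerRight A a.iso.hom g)

@[simp] theorem wrc_lw (f : A ⟶ A') (a : ICell A' A'') :
    wrc (lw f a) B = lw (wr f B) (wrc a B) :=
  ext_hom (wr_comp _ _ _) (wr_comp _ _ _) (wr₂_whiskerLeft f a.iso.hom B)

@[simp] theorem wrc_rw (a : ICell A A') (f : A' ⟶ A'') :
    wrc (rw a f) B = rw (wrc a B) (wr f B) :=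
  ext_hom (wr_comp _ _ _) (wr_comp _ _ _) (wr₂_whiskerRight a.iso.hom f B)

theorem unit_wlc (a : ICell B B') : rw (wlc (𝕀 C) a) (lu B') = lw (lu B) a :=
  ext_hom (unit_wl _) (unit_wl _) (unit_wl₂ a.iso.hom)

theorem unit_wrc (a : ICell A A') : rw (wrc a (𝕀 C)) (ru A') = lw (ru A) a :=
  ext_hom (wr_unit _) (wr_unit _) (wr₂_unit a.iso.hom)

theorem intc_naturality_left (a : ICell A A') (g : B ⟶ B') :
    comp (lw (wl A g) (wrc a B')) (intc a.tgt g) (by simp) =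
      comp (intc a.src g) (rw (wrc a B) (wl A' g)) (by simp) := by
  obtain ⟨s, t, i⟩ := a
  change comp (of (whiskerLeftIso (wl A g) (wrIso i B'))) (of (inter t g)) _ =
    comp (of (inter s g)) (of (whiskerRightIso (wrIso i B) (wl A' g))) _
  rw [← of_trans, ← of_trans]
  refine congrArg of ?_
  ext
  exact inter_naturality_left i.hom g

theorem intc_naturality_right (f : A ⟶ A') (a : ICell B B') :
    comp (rw (wlc A a) (wr f B')) (intc f a.tgt) (by simp) =
      comp (intc f a.src) (lw (wr f B) (wlc A' a)) (by simp) := by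
  obtain ⟨s, t, i⟩ := a
  change comp (of (whiskerRightIso (wlIso A i) (wr f B'))) (of (inter f t)) _ =
    comp (of (inter f s)) (of (whiskerLeftIso (wr f B) (wlIso A' i))) _
  rw [← of_trans, ← of_trans]
  refine congrArg of ?_
  ext
  exact inter_naturality_right f i.hom

@[simp] theorem intc_id_left (A : C) (g : B ⟶ B') : intc (𝟙 A) g = id (wl A g) := by
  have e : inter (𝟙 A) g = eqToIso (by simp) := by ext; exact inter_id_left A g
  simpa using congrArg of e

@[simp] theorem intc_id_right (f : A ⟶ A') (B : C) : intc f (𝟙 B) = id (wr f B) := by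
  have e : inter f (𝟙 B) = eqToIso (by simp) := by ext; exact inter_id_right f B
  simpa using congrArg of e

/-- Rebracketings and unit identifications are of this form, so interchangers with them may be
dropped. -/
theorem intc_eqToHom_left (h : A = A') (g : B ⟶ B') :
    intc (eqToHom h) g = id (wl A g ≫ wr (eqToHom h) B') := by
  subst h; simp

theorem intc_eqToHom_right (f : A ⟶ A') (h : B = B') :
    intc f (eqToHom h) = id (wr f B ≫ wl A' (eqToHom h)) := by
  subst h; simp

theorem intc_comp_left (f : A ⟶ A') (f' : A' ⟶ A'') (g : B ⟶ B') :
    intc (f ≫ f') g = comp (rw (intc f g) (wr f' B')) (lw (wr f B) (intc f' g)) (by simp) := by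
  have e : inter (f ≫ f') g =
      eqToIso (by simp) ≪≫ whiskerRightIso (inter f g) (wr f' B') ≪≫
        eqToIso (Strict.assoc _ _ _) ≪≫ whiskerLeftIso (wr f B) (inter f' g) ≪≫
          eqToIso (by simp) := by
    ext; simpa using inter_comp_left f f' g
  have e' := congrArg of e
  simpa using e'

theorem intc_comp_right (f : A ⟶ A') (g : B ⟶ B') (g' : B' ⟶ B'') :
    intc f (g ≫ g') = comp (lw (wl A g) (intc f g')) (rw (intc f g) (wl A' g')) (by simp) := by
  have e : inter f (g ≫ g') =
      eqToIso (by simp) ≪≫ whiskerLeftIso (wl A g) (inter f g') ≪≫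
        eqToIso (Strict.assoc _ _ _).symm ≪≫ whiskerRightIso (inter f g) (wl A' g') ≪≫
          eqToIso (by simp) := by
    ext; simpa using inter_comp_right f g g'
  have e' := congrArg of e
  simpa using e'

theorem intc_wl (g : B ⟶ B') (h : D ⟶ D') :
    rw (intc (wl A g) h) (as A B' D') = lw (as A B D) (wlc A (intc g h)) :=
  ext_hom (by simp) (by simp) (inter_wl A g h)

theorem intc_wr_wl (f : A ⟶ A') (B : C) (h : D ⟶ D') :
    rw (intc (wr f B) h) (as A' B D') = lw (as A B D) (intc f (wl B h)) :=
  ext_hom (by simp) (by simp) (inter_wr_wl f B h)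

theorem intc_wr (f : A ⟶ A') (g : B ⟶ B') (D : C) :
    rw (wrc (intc f g) D) (as A' B' D) = lw (as A B D) (intc f (wr g D)) :=
  ext_hom (by simp) (by simp) (inter_wr f g D)

end ICell
end LaxSpan

/-! ### Inserting a 1-cell out of the unit into a product. -/

namespace LaxSpan

open GrayMonoid ICell

section Right

variable {C : Type u} [Bicategory.{w, v} C] [Bicategory.Strict C] [GrayMonoid C]
variable {A A' A'' B B' B'' D D' H X Y Z : C}

/-- Insertion of the element `f` on the left. -/
def insL (f : 𝕀 C ⟶ H) (X : C) : X ⟶ H ⊡ X := lu' X ≫ wr f X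

/-- Insertion of the element `f` on the right. -/
def insR (f : 𝕀 C ⟶ H) (X : C) : X ⟶ X ⊡ H := ru' X ≫ wl X f

/-- The 1-cell `μ` applied to the first two factors of a right-bracketed product. -/
def act (μ : A ⊡ B ⟶ D) (X : C) : A ⊡ (B ⊡ X) ⟶ D ⊡ X := as' A B X ≫ wr μ X

theorem wl_wr_as' (A : C) (g : B ⟶ B') (D : C) (k : (A ⊡ B') ⊡ D ⟶ Z) :
    wl A (wr g D) ≫ as' A B' D ≫ k = as' A B D ≫ wr (wl A g) D ≫ k := by
  have e : k = as A B' D ≫ as' A B' D ≫ k := by simp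
  conv_rhs => rw [e, wr_wl_assoc]
  simp

theorem lu'_naturality (g : B ⟶ B') : lu' B ≫ wl (𝕀 C) g = g ≫ lu' B' := by
  simpa using lu'_wl g (𝟙 _)

theorem ru'_naturality (g : B ⟶ B') : ru' B ≫ wr g (𝕀 C) = g ≫ ru' B' := by
  simpa using ru'_wr g (𝟙 _)

theorem as'_wl (A B : C) (h : D ⟶ D') :
    as' A B D ≫ wl (A ⊡ B) h = wl A (wl B h) ≫ as' A B D' := by
  simpa using (wl_as' A B h (𝟙 _)).symm

theorem insL_comp (f : 𝕀 C ⟶ H) (p : H ⟶ D) (X : C) : insL (f ≫ p) X = insL f X ≫ wr p X := by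
  simp [insL]

theorem insR_comp (f : 𝕀 C ⟶ H) (p : H ⟶ D) (X : C) : insR (f ≫ p) X = insR f X ≫ wl X p := by
  simp [insR]

theorem insR_tensor (f : 𝕀 C ⟶ H) (A B : C) :
    insR f (A ⊡ B) = wl A (insR f B) ≫ as' A B H := by
  have := wl_as' A B f (𝟙 _)
  simp only [Strict.comp_id] at this
  simp [insR, wl_eqToHom, this]

theorem wr_insL (g : 𝕀 C ⟶ H) (X Y : C) : wr (insL g X) Y = insL g (X ⊡ Y) ≫ as' H X Y := by
  have := wr_as' g X Y (𝟙 _)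
  simp only [Strict.comp_id] at this
  simp [insL, wr_eqToHom, this]

/-- An element placed between `X` and `Y` stands both to the right of `X` and to the left of `Y`.
This exchanges right insertions for left ones. -/
theorem wr_insR (g : 𝕀 C ⟶ H) (X Y : C) :
    wr (insR g X) Y = wl X (insL g Y) ≫ as' X H Y := by
  have := wl_wr_as' X g Y (𝟙 _)
  simp only [Strict.comp_id] at this
  simp [insL, insR, wr_eqToHom, wl_eqToHom, this]

theorem wr_insR_comp (g : 𝕀 C ⟶ H) (μ : A ⊡ H ⟶ D) (Y : C) :
    wr (insR g A ≫ μ) Y = wl A (insL g Y) ≫ act μ Y := by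
  rw [wr_comp, wr_insR, Strict.assoc, act]

namespace ICell

/-- Insertion on the left is pseudonatural. -/
def nL (f : 𝕀 C ⟶ H) (k : X ⟶ Y) : ICell X (H ⊡ Y) := lw (lu' X) (intc f k)

/-- `act μ` is pseudonatural. -/
def nA (μ : A ⊡ B ⟶ D) (k : X ⟶ Y) : ICell (A ⊡ (B ⊡ X)) (D ⊡ Y) := lw (as' A B X) (intc μ k)

/-- Insertion on the right is compatible with `μ`. -/
def nR (μ : A ⊡ B ⟶ D) (f : 𝕀 C ⟶ H) : ICell (A ⊡ B) (D ⊡ H) := lw (ru' (A ⊡ B)) (intc μ f)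

@[simp] theorem nL_src (f : 𝕀 C ⟶ H) (k : X ⟶ Y) : (nL f k).src = k ≫ insL f Y := by
  simp [nL, insL, lu'_wl]

@[simp] theorem nL_tgt (f : 𝕀 C ⟶ H) (k : X ⟶ Y) : (nL f k).tgt = insL f X ≫ wl H k := by
  simp [nL, insL]

@[simp] theorem nA_src (μ : A ⊡ B ⟶ D) (k : X ⟶ Y) :
    (nA μ k).src = wl A (wl B k) ≫ act μ Y := by
  simp [nA, act, wl_as']

@[simp] theorem nA_tgt (μ : A ⊡ B ⟶ D) (k : X ⟶ Y) : (nA μ k).tgt = act μ X ≫ wl D k := by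
  simp [nA, act]

@[simp] theorem nR_src (μ : A ⊡ B ⟶ D) (f : 𝕀 C ⟶ H) :
    (nR μ f).src = wl A (insR f B) ≫ act μ H := by
  have := insR_tensor f A B
  simp only [nR, lw_src, intc_src, act, ← Strict.assoc] at this ⊢
  rw [← this, insR]

@[simp] theorem nR_tgt (μ : A ⊡ B ⟶ D) (f : 𝕀 C ⟶ H) : (nR μ f).tgt = μ ≫ insR f D := by
  simp [nR, insR, ru'_wr]

theorem nL_comp (f : 𝕀 C ⟶ H) (k : X ⟶ Y) (k' : Y ⟶ Z) :
    nL f (k ≫ k') = comp (lw k (nL f k')) (rw (nL f k) (wl H k')) (by simp) := by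
  simp only [nL, intc_comp_right, lw_comp, lw_lw, rw_lw, lu'_naturality]

theorem nA_comp (μ : A ⊡ B ⟶ D) (k : X ⟶ Y) (k' : Y ⟶ Z) :
    nA μ (k ≫ k') =
      comp (lw (wl A (wl B k)) (nA μ k')) (rw (nA μ k) (wl D k')) (by simp) := by
  simp only [nA, intc_comp_right, lw_comp, lw_lw, rw_lw, as'_wl]

theorem lw_lu'_wlc (a : ICell X Y) : lw (lu' X) (wlc (𝕀 C) a) = rw a (lu' Y) := by
  have e := congrArg (fun c => lw (lu' X) (rw c (lu' Y))) (unit_wlc a)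
  simpa using e

theorem lw_ru'_wrc (a : ICell X Y) : lw (ru' X) (wrc a (𝕀 C)) = rw a (ru' Y) := by
  have e := congrArg (fun c => lw (ru' X) (rw c (ru' Y))) (unit_wrc a)
  simpa using e

theorem nL_naturality (f : 𝕀 C ⟶ H) (a : ICell X Y) :
    comp (rw a (insL f Y)) (nL f a.tgt) (by simp) =
      comp (nL f a.src) (lw (insL f X) (wlc H a)) (by simp) := by
  have e := congrArg (lw (lu' X)) (intc_naturality_right f a)
  simp only [lw_comp, ← rw_lw, lw_lu'_wlc, rw_rw, lw_lw] at e
  exact e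

theorem intc_insR (g : 𝕀 C ⟶ H) (A : C) (k : X ⟶ Y) :
    intc (insR g A) k = rw (wlc A (nL g k)) (as' A H Y) := by
  have e := congrArg (fun c => rw c (as' A H Y)) (intc_wl (A := A) g k)
  simp only [rw_rw, rw_lw, eqToHom_trans, eqToHom_refl, rw_id_one] at e
  rw [insR, intc_comp_left]
  simp [e, intc_eqToHom_left, wr_eqToHom, nL, wl_eqToHom]

theorem intc_insL (g : 𝕀 C ⟶ H) (A : C) (k : X ⟶ Y) :
    intc (insL g A) k = rw (nL g (wl A k)) (as' H A Y) := by
  have e := congrArg (fun c => rw c (as' H A Y)) (intc_wr_wl g A k)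
  simp only [rw_rw, rw_lw, eqToHom_trans, eqToHom_refl, rw_id_one] at e
  rw [insL, intc_comp_left]
  simp [e, intc_eqToHom_left, wr_eqToHom, nL]

/-- The interchanger of a right translation. -/
theorem intc_insR_comp (g : 𝕀 C ⟶ H) (μ : A ⊡ H ⟶ D) (k : X ⟶ Y) :
    intc (insR g A ≫ μ) k =
      comp (rw (wlc A (nL g k)) (act μ Y)) (lw (wl A (insL g X)) (nA μ k)) (by simp) := by
  simp [intc_comp_left, intc_insR, wr_insR, nA, act]

/-- Composite 1-morphisms of `M` have this shape (`compMor_eq_insR`). Passing a composite across `k`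
means passing `h`, then `g`, then the multiplication `μ`. -/
theorem nL_comp_left (h : 𝕀 C ⟶ A) (g : 𝕀 C ⟶ H) (μ : A ⊡ H ⟶ D) (k : X ⟶ Y) :
    nL (h ≫ insR g A ≫ μ) k =
      comp (rw (nL h k) (wl A (insL g Y) ≫ act μ Y))
        (comp (lw (insL h X) (rw (wlc A (nL g k)) (act μ Y)))
          (lw (insL h X ≫ wl A (insL g X)) (nA μ k)) (by simp)) (by simp) := by
  rw [nL, intc_comp_left]
  simp only [intc_insR_comp, wr_insR_comp]
  simp [nL, insL]

/-- Meant for `p = pre f z`, since `compMor f g = g ≫ pre f z`. -/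
theorem nR_comp_right (μ : A ⊡ B ⟶ D) (g : 𝕀 C ⟶ H) (p : H ⟶ H') :
    nR μ (g ≫ p) =
      comp (lw (wl A (insR g B)) (nA μ p)) (rw (nR μ g) (wl D p)) (by simp) := by
  have := insR_tensor g A B
  simp only [insR] at this
  simp [nR, intc_comp_right, nA, this, insR]

end ICell

end Right

end LaxSpan

/-! ### The enriched associator and the pentagon on right-bracketed products. -/

namespace LaxSpan

open GrayMonoid ICell

namespace EnrichedBicategory

variable {C : Type u} [Bicategory.{w, v} C] [Bicategory.Strict C] [GrayMonoid C]
variable (M : EnrichedBicategory.{w, v, u, u'} C)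

/-- The enriched associator, on a right-bracketed product. -/
def assoc (x y z t : M.Obj) : ICell (M.hom z t ⊡ M.hom y z ⊡ M.hom x y) (M.hom x t) :=
  lw (as' _ _ _) (of (M.pi x y z t))

/-- The enriched associator, applied to the first three factors of a right-bracketed product. -/
def assocTensor (x y z t : M.Obj) (X : C) :
    ICell (M.hom z t ⊡ M.hom y z ⊡ M.hom x y ⊡ X) (M.hom x t ⊡ X) :=
  lw (as' _ _ _ ≫ as' _ _ _) (wrc (of (M.pi x y z t)) X)

@[simp] theorem assoc_src (x y z t : M.Obj) :
    (M.assoc x y z t).src = act (M.m y z t) (M.hom x y) ≫ M.m x y t := by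
  simp [assoc, act]

@[simp] theorem assoc_tgt (x y z t : M.Obj) :
    (M.assoc x y z t).tgt = wl (M.hom z t) (M.m x y z) ≫ M.m x z t := by
  simp [assoc]

@[simp] theorem assocTensor_src (x y z t : M.Obj) (X : C) :
    (M.assocTensor x y z t X).src =
      act (M.m y z t) (M.hom x y ⊡ X) ≫ act (M.m x y t) X := by
  have := wr_as' (M.m y z t) (M.hom x y) X (wr (M.m x y t) X)
  simp [assocTensor, act, this]

@[simp] theorem assocTensor_tgt (x y z t : M.Obj) (X : C) :
    (M.assocTensor x y z t X).tgt =
      wl (M.hom z t) (act (M.m x y z) X) ≫ act (M.m x z t) X := by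
  have := wl_wr_as' (M.hom z t) (M.m x y z) X (wr (M.m x z t) X)
  simp [assocTensor, act, this, wl_eqToHom, wr_eqToHom]

theorem pentagon_bundled (x y z s t : M.Obj) :
    comp (rw (wrc (of (M.pi y z s t)) (M.hom x y)) (M.m x y t))
      (comp (lw (wr (as (M.hom s t) (M.hom z s) (M.hom y z)) (M.hom x y) ≫
            wr (wl (M.hom s t) (M.m y z s)) (M.hom x y)) (of (M.pi x y s t)))
        (lw (wr (as (M.hom s t) (M.hom z s) (M.hom y z)) (M.hom x y) ≫
            as (M.hom s t) (M.hom z s ⊡ M.hom y z) (M.hom x y))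
          (rw (wlc (M.hom s t) (of (M.pi x y z s))) (M.m x s t))) (by simp)) (by simp) =
    comp (lw (wr (wr (M.m z s t) (M.hom y z)) (M.hom x y)) (of (M.pi x y z t)))
      (comp (rw (lw (as (M.hom s t ⊡ M.hom z s) (M.hom y z) (M.hom x y))
          (intc (M.m z s t) (M.m x y z)).symm) (M.m x z t))
        (lw (as (M.hom s t ⊡ M.hom z s) (M.hom y z) (M.hom x y) ≫
            wl (M.hom s t ⊡ M.hom z s) (M.m x y z)) (of (M.pi x z s t))) (by simp)) (by simp) := by
  -- The pentagon axiom at the level of isomorphisms; its `eqToIso` factors vanish under `of`.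
  have e : whiskerRightIso (wrIso (M.pi y z s t) (M.hom x y)) (M.m x y t) ≪≫
      eqToIso (by simp) ≪≫
      whiskerLeftIso (wr (as (M.hom s t) (M.hom z s) (M.hom y z)) (M.hom x y) ≫
        wr (wl (M.hom s t) (M.m y z s)) (M.hom x y)) (M.pi x y s t) ≪≫
      eqToIso (by simp) ≪≫
      whiskerLeftIso (wr (as (M.hom s t) (M.hom z s) (M.hom y z)) (M.hom x y) ≫
        as (M.hom s t) (M.hom z s ⊡ M.hom y z) (M.hom x y))
        (whiskerRightIso (wlIso (M.hom s t) (M.pi x y z s)) (M.m x s t)) =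
    eqToIso (by simp) ≪≫
      whiskerLeftIso (wr (wr (M.m z s t) (M.hom y z)) (M.hom x y)) (M.pi x y z t) ≪≫
      eqToIso (by simp) ≪≫
      whiskerRightIso (whiskerLeftIso (as (M.hom s t ⊡ M.hom z s) (M.hom y z) (M.hom x y))
        (inter (M.m z s t) (M.m x y z)).symm) (M.m x z t) ≪≫
      eqToIso (by simp) ≪≫
      whiskerLeftIso (as (M.hom s t ⊡ M.hom z s) (M.hom y z) (M.hom x y) ≫
        wl (M.hom s t ⊡ M.hom z s) (M.m x y z)) (M.pi x z s t) ≪≫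
      eqToIso (by simp [wl_eqToHom, wr_eqToHom]) := by
    ext
    exact M.pentagon x y z s t
  have e' := congrArg of e
  simpa using e'

/-- The associativity equation, on right-bracketed products. -/
theorem pentagon_assoc (x y z s t : M.Obj) :
    comp (rw (M.assocTensor y z s t (M.hom x y)) (M.m x y t))
      (comp (lw (wl (M.hom s t) (act (M.m y z s) (M.hom x y))) (M.assoc x y s t))
        (rw (wlc (M.hom s t) (M.assoc x y z s)) (M.m x s t)) (by simp)) (by simp) =
    comp (lw (act (M.m z s t) (M.hom y z ⊡ M.hom x y)) (M.assoc x y z t))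
      (comp (rw (nA (M.m z s t) (M.m x y z)).symm (M.m x z t))
        (lw (wl (M.hom s t) (wl (M.hom z s) (M.m x y z))) (M.assoc x z s t)) (by simp))
      (by simp) := by
  -- Restriction along the rebracketing 1-cells turns the left-bracketed pentagon into the
  -- right-bracketed one.
  have e := congrArg (lw (as' (M.hom s t) (M.hom z s) (M.hom y z ⊡ M.hom x y) ≫
    as' (M.hom s t ⊡ M.hom z s) (M.hom y z) (M.hom x y))) (M.pentagon_bundled x y z s t)
  have h1 := wr_as' (M.m z s t) (M.hom y z) (M.hom x y) (𝟙 _)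
  have h2 := wl_wr_as' (M.hom s t) (M.m y z s) (M.hom x y) (𝟙 _)
  simp only [Strict.comp_id] at h1 h2
  have h3 := as'_wl (M.hom s t) (M.hom z s) (M.m x y z)
  simp [wr_eqToHom] at e
  simp [assoc, assocTensor, nA, act, wl_eqToHom, h1, h2, ← h3]
  exact e

/-- The enriched associator commutes with insertion on the right. -/
theorem assoc_insR (x y z t : M.Obj) {H : C} (f : 𝕀 C ⟶ H) :
    comp (lw (wl (M.hom z t) (wl (M.hom y z) (insR f (M.hom x y)))) (M.assocTensor x y z t H))
      (comp (rw (wlc (M.hom z t) (nR (M.m x y z) f)) (act (M.m x z t) H))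
        (lw (wl (M.hom z t) (M.m x y z)) (nR (M.m x z t) f)) (by simp)) (by simp) =
    comp (rw (nA (M.m y z t) (insR f (M.hom x y))) (act (M.m x y t) H))
      (comp (lw (act (M.m y z t) (M.hom x y)) (nR (M.m x y t) f))
        (rw (M.assoc x y z t) (insR f (M.hom x t))) (by simp)) (by simp) := by
  -- The content is naturality of the interchanger in its left variable, applied to the associator
  -- and `f`. The rest splits the interchangers of the two ends of the associator, which are
  -- composites.
  have e := congrArg (lw (as' (M.hom z t) (M.hom y z) (M.hom x y) ≫ ru' _))
    (intc_naturality_left (of (M.pi x y z t)) f)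
  have h1 := congrArg (fun c => rw c (as' (M.hom y t) (M.hom x y) H))
    (intc_wr_wl (M.m y z t) (M.hom x y) f)
  have h2 := congrArg (fun c => rw c (as' (M.hom z t) (M.hom x z) H))
    (intc_wl (A := M.hom z t) (M.m x y z) f)
  simp only [rw_rw, rw_lw, eqToHom_trans, eqToHom_refl, rw_id_one] at h1 h2
  have h3 : wl (M.hom z t) (wl (M.hom y z) (wl (M.hom x y) f)) ≫
      as' (M.hom z t) (M.hom y z) (M.hom x y ⊡ H) ≫ as' (M.hom z t ⊡ M.hom y z) (M.hom x y) H =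
      as' _ _ _ ≫ as' _ _ _ ≫ wl ((M.hom z t ⊡ M.hom y z) ⊡ M.hom x y) f := by
    rw [as'_wl, wl_as']
  have h4 := lw_ru'_wrc (of (M.pi x y z t))
  have h5 := congrArg (fun c => rw c (wl (M.hom x t) f)) h4
  have h6 := ru'_naturality (wl (M.hom z t) (M.m x y z))
  have h7 := ru'_naturality (wr (M.m y z t) (M.hom x y))
  simp only [rw_rw, rw_lw] at h5
  simp [intc_comp_left, intc_eqToHom_left, h1, h2, wr_eqToHom] at e
  simp [assoc, assocTensor, nA, nR, insR, intc_comp_right, act, intc_eqToHom_right, ← h5, ← h6,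
    ← h7, wl_eqToHom]
  simp at h3
  simp [h3]
  exact e

end EnrichedBicategory
end LaxSpan

/-! ### Push-forward, pullback and their canonical isomorphisms in terms of insertions. -/

namespace LaxSpan

open GrayMonoid ICell

namespace EnrichedBicategory

variable {C : Type u} [Bicategory.{w, v} C] [Bicategory.Strict C] [GrayMonoid C]
variable {M : EnrichedBicategory.{w, v, u, u'} C} {x y z t : M.Obj}

theorem post_eq (f : M.Mor x y) (s : M.Obj) :
    post f s = insL f (M.hom s x) ≫ M.m s x y := by
  simp [post, insL]

theorem pre_eq (f : M.Mor x y) (s : M.Obj) :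
    pre f s = insR f (M.hom y s) ≫ M.m x y s := by
  simp [pre, insR]

theorem compMor_eq_insR (f : M.Mor x y) (g : M.Mor y z) :
    compMor f g = g ≫ insR f (M.hom y z) ≫ M.m x y z := by
  rw [compMor_eq, pre_eq]

theorem insL_compMor (f : M.Mor x y) (g : M.Mor y z) (X : C) :
    insL (compMor f g) X = insL g X ≫ wl (M.hom y z) (insL f X) ≫ act (M.m x y z) X := by
  rw [compMor_eq_insR, insL_comp, wr_insR_comp]

theorem nL_compMor (f : M.Mor x y) (g : M.Mor y z) {X Y : C} (k : X ⟶ Y) :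
    nL (compMor f g) k =
      comp (rw (nL g k) (wl (M.hom y z) (insL f Y) ≫ act (M.m x y z) Y))
        (comp (lw (insL g X) (rw (wlc (M.hom y z) (nL f k)) (act (M.m x y z) Y)))
          (lw (insL g X ≫ wl (M.hom y z) (insL f X)) (nA (M.m x y z) k)) (by simp))
        (by simp) := by
  rw [compMor_eq_insR, nL_comp_left]

/-- The pullback along `f` is compatible with the actions by composition on the left. -/
def preAct (f : M.Mor x y) (z t : M.Obj) : ICell (M.hom z t ⊡ M.hom y z) (M.hom x t) :=
  comp (lw (wl (M.hom z t) (insR f (M.hom y z))) (M.assoc x y z t).symm)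
    (rw (nR (M.m y z t) f) (M.m x y t)) (by simp)

theorem preAct_eq (f : M.Mor x y) (z t : M.Obj) :
    preAct f z t = comp (lw (wl (M.hom z t) (insR f (M.hom y z))) (M.assoc x y z t).symm)
      (rw (nR (M.m y z t) f) (M.m x y t)) (by simp) := rfl

@[simp] theorem preAct_src (f : M.Mor x y) (z t : M.Obj) :
    (preAct f z t).src = wl (M.hom z t) (pre f z) ≫ M.m x z t := by
  simp [preAct, pre_eq]

@[simp] theorem preAct_tgt (f : M.Mor x y) (z t : M.Obj) :
    (preAct f z t).tgt = M.m y z t ≫ pre f t := by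
  simp [preAct, pre_eq]

/-- `preAct f` compares `b ∘ (a ∘ f)` with `(b ∘ a) ∘ f`; fixing `a = g` gives the comparison for a
composite pullback. -/
theorem of_preComp (f : M.Mor x y) (g : M.Mor y z) (s : M.Obj) :
    of (preComp f g s) = lw (insR g (M.hom z s)) (preAct f z s) := by
  have h := as'_wl (M.hom z s) (M.hom y z) f
  simp [preComp, preAct, assoc, nR, insR, wl_eqToHom, ← h]

theorem of_postComp (f : M.Mor x y) (g : M.Mor y z) (s : M.Obj) :
    of (postComp f g s) =
      comp (lw (insL g (M.hom s x) ≫ wl (M.hom y z) (insL f (M.hom s x))) (M.assoc s x y z))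
        (rw (nL g (post f s)).symm (M.m s y z)) (by simp [post_eq]) := by
  have h : wr (ru' (𝕀 C)) (M.hom s x) ≫ wr (wr g (𝕀 C)) (M.hom s x) ≫
      wr (wl (M.hom y z) f) (M.hom s x) = wr g (M.hom s x) ≫ wl (M.hom y z) (lu' (M.hom s x)) ≫
        wl (M.hom y z) (wr f (M.hom s x)) ≫ as' (M.hom y z) (M.hom x y) (M.hom s x) := by
    rw [← Strict.assoc, ← wr_comp, ru'_naturality, wr_comp, Strict.assoc]
    refine congrArg (wr g (M.hom s x) ≫ ·) ?_
    simpa [insL, insR] using wr_insR f (M.hom y z) (M.hom s x)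
  simp [postComp, assoc, nL, insL, h]

/-- Here `b = g` is fixed in `preAct f` instead, after `g` has been moved past `f^*`. The definition
of `exch` uses the interchangers in another order; the two agree because the interchanger of `g`
with the insertion of `f` slides past the associator. -/
theorem of_exch (f : M.Mor x y) (g : M.Mor z t) :
    of (exch f g) =
      comp (rw (nL g (pre f z)) (M.m x z t)) (lw (insL g (M.hom y z)) (preAct f z t))
        (by simp) := by
  have e : exch f g =
      eqToIso (by simp [pre_eq, post_eq, insR, insL, lu'_wl]) ≪≫
      whiskerLeftIso (ru' (M.hom y z) ≫ wl (M.hom y z) f ≫ lu' _)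
        (whiskerRightIso (inter g (M.m x y z)) (M.m x z t)) ≪≫
      eqToIso (by simp) ≪≫
      whiskerLeftIso (ru' (M.hom y z) ≫ wl (M.hom y z) f ≫ lu' _ ≫
          as' (𝕀 C) (M.hom y z) (M.hom x y) ≫ wr (wr g (M.hom y z)) (M.hom x y))
        (M.pi x y z t).symm ≪≫
      eqToIso (by simp [post_eq, insL, wr_eqToHom]) ≪≫
      whiskerLeftIso (ru' (M.hom y z)) (whiskerRightIso (inter (post g y) f) (M.m x y t)) ≪≫
      eqToIso (by simp [pre_eq, insR, ru'_wr]) := rfl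
  have e1 : lu' (M.hom y z ⊡ M.hom x y) ≫ as' (𝕀 C) (M.hom y z) (M.hom x y) ≫
      wr (wr g (M.hom y z)) (M.hom x y) = insL g (M.hom y z ⊡ M.hom x y) ≫ as' _ _ _ := by
    have := wr_insL g (M.hom y z) (M.hom x y)
    simp only [insL, wr_comp, wr_eqToHom] at this
    simp only [insL, Strict.assoc] at this ⊢
    rw [← this]
    simp
  -- `post g y` is the insertion of `g` followed by composition, so its interchanger with `f` has
  -- two factors; the first is the one that slides.
  have e2 : intc (post g y) f =
      comp (rw (nL g (wl (M.hom y z) f)) (act (M.m y z t) (M.hom x y)))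
        (lw (wr (insL g (M.hom y z)) (𝕀 C)) (intc (M.m y z t) f))
        (by simp [wr_insL, act, wl_as']) := by
    rw [post_eq, intc_comp_left]
    simp only [intc_insL]
    simp [act]
  have e3 : nL g (insR f (M.hom y z)) = lw (ru' (M.hom y z)) (nL g (wl (M.hom y z) f)) := by
    rw [insR, nL_comp]
    simp [nL, intc_eqToHom_right]
  have e4 := exchange (nL g (insR f (M.hom y z))) (M.assoc x y z t).symm
  simp only [symm_src, symm_tgt, assoc_src, assoc_tgt, nL_src, nL_tgt] at e4
  simp only [eqToHom_trans_assoc] at e1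
  rw [e]
  simp only [pre_eq, nL_comp, preAct, rw_comp, lw_comp, comp_assoc, lw_lw, rw_rw, rw_lw]
  have e5 := comp_comp_congr e4
    (e := lw (insL g (M.hom y z)) (rw (nR (M.m y z t) f) (M.m x y t))) (by simp)
  simp only [e5]
  simp only [e3]
  simp [e2, insR, nL, nR, assoc, e1, ← ru'_naturality]

end EnrichedBicategory
end LaxSpan

/-! ### Pullback as a map of left modules over composition. -/

namespace LaxSpan

open GrayMonoid ICell

namespace EnrichedBicategory

variable {C : Type u} [Bicategory.{w, v} C] [Bicategory.Strict C] [GrayMonoid C]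
variable {M : EnrichedBicategory.{w, v, u, u'} C} {x y z t : M.Obj}

theorem of_preIso {f f' : M.Mor x y} (a : f ≅ f') (s : M.Obj) :
    of (preIso a s) = lw (ru' (M.hom y s)) (rw (wlc (M.hom y s) (of a)) (M.m x y s)) := by
  exact of_whiskerLeftIso _ _

theorem of_postIso {f f' : M.Mor x y} (a : f ≅ f') (s : M.Obj) :
    of (postIso a s) = lw (lu' (M.hom s x)) (rw (wrc (of a) (M.hom s x)) (M.m s x y)) := by
  exact of_whiskerLeftIso _ _

theorem of_assocMor (f : M.Mor x y) (g : M.Mor y z) (h : M.Mor z t) :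
    of (assocMor f g h) = lw (h ≫ insR g (M.hom z t)) (preAct f z t).symm := by
  simp only [assocMor, of_trans, of_eqToIso, of_whiskerLeftIso, of_symm, of_preComp]
  simp

theorem of_preIso_assocMor (f : M.Mor x y) (g : M.Mor y z) (h : M.Mor z t) (s : M.Obj) :
    of (preIso (assocMor f g h) s) =
      lw (insR h (M.hom t s) ≫ wl (M.hom t s) (insR g (M.hom z t)))
        (rw (wlc (M.hom t s) (preAct f z t).symm) (M.m x t s)) := by
  rw [of_preIso, of_assocMor]
  simp [insR]

/-- The 2-cell `preAct`, tensored with `X`. -/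
def preActTensor (f : M.Mor x y) (z t : M.Obj) (X : C) :
    ICell (M.hom z t ⊡ M.hom y z ⊡ X) (M.hom x t ⊡ X) :=
  comp (lw (wl (M.hom z t) (wl (M.hom y z) (insL f X))) (M.assocTensor x y z t X).symm)
    (rw (nA (M.m y z t) (insL f X)) (act (M.m x y t) X)) (by simp)

/-- Tensoring with `X` on the right puts `f` between two factors, so its right insertion becomes a
left insertion next to `X`, and `nR` becomes `nA`. This form is needed for `f_*`, where the free
entry stands to the right of `f`. -/
theorem wrc_preAct (f : M.Mor x y) (z t : M.Obj) (X : C) :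
    lw (as' _ _ _) (wrc (preAct f z t) X) = preActTensor f z t X := by
  have h1 := congrArg (fun c => rw c (as' _ _ _)) (intc_wr (M.m y z t) f X)
  have h2 := wr_insR f (M.hom y z) X
  have h3 := wl_wr_as' (M.hom z t) (insR f (M.hom y z)) X (wr (as' _ _ (M.hom x y)) X)
  rw [h2] at h3
  simp only [rw_rw, rw_lw, eqToHom_trans, eqToHom_refl, rw_id_one] at h1
  simp [preAct, preActTensor, nR, nA, assoc, assocTensor, h1, ← h3]
  simp [insL, intc_comp_right, intc_eqToHom_right, wl_eqToHom, wr_eqToHom, act]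

theorem of_postIso_assocMor (f : M.Mor x y) (g : M.Mor y z) (h : M.Mor z t) (s : M.Obj) :
    of (postIso (assocMor f g h) s) =
      lw (insL h (M.hom s x) ≫ wl (M.hom z t) (insL g (M.hom s x)))
        (rw (preActTensor f z t (M.hom s x)).symm (M.m s x t)) := by
  rw [of_postIso, of_assocMor, ← wrc_preAct]
  simp [wr_insR]
  simp [insL]

/-- The pentagon with last entry `f`: two ways from `(c ∘ b) ∘ (a ∘ f)` to `(c ∘ (b ∘ a)) ∘ f`.
`pentagon_assoc` handles the associators, `assoc_insR` the insertion of `f`, and two interchange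
laws the rest. -/
theorem preAct_act (f : M.Mor x y) (z t s : M.Obj) :
    comp (lw (wl (M.hom t s) (wl (M.hom z t) (pre f z))) (M.assoc x z t s))
      (comp (rw (wlc (M.hom t s) (preAct f z t)) (M.m x t s))
        (lw (wl (M.hom t s) (M.m y z t)) (preAct f t s)) (by simp)) (by simp) =
    comp (rw (nA (M.m z t s) (pre f z)) (M.m x z s))
      (comp (lw (act (M.m z t s) (M.hom y z)) (preAct f z s))
        (rw (M.assoc y z t s) (pre f s)) (by simp)) (by simp) := by
  have hA := exchange (wlc (M.hom t s) (nR (M.m y z t) f)) (M.assoc x y t s).symm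
  have hB := comp_rotate (M.pentagon_assoc x y z t s)
  have hB' := congrArg (lw (wl (M.hom t s) (wl (M.hom z t) (insR f (M.hom y z))))) hB
  have hC := congrArg (fun c => rw c (M.m x y s)) (M.assoc_insR y z t s f)
  have hD := exchange (nA (M.m z t s) (insR f (M.hom y z))) (M.assoc x y z s).symm
  simp at hA hB' hC hD
  simp [preAct, nA_comp, pre_eq]
  simp only [comp_comp_congr hA, comp_comp_comp_congr hB', hC, comp_comp_congr hD]

end EnrichedBicategory
end LaxSpan

/-! ### The four coherence equations. -/

namespace LaxSpan

open GrayMonoid ICell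

namespace EnrichedBicategory

variable {C : Type u} [Bicategory.{w, v} C] [Bicategory.Strict C] [GrayMonoid C]
variable {M : EnrichedBicategory.{w, v, u, u'} C} {x y z t : M.Obj}

/-- The case `a = g` of `preAct_act`: two ways from `c ∘ (b ∘ (g ∘ f))` to `((c ∘ b) ∘ g) ∘ f`. -/
theorem preAct_compMor (f : M.Mor x y) (g : M.Mor y z) (t s : M.Obj) :
    comp (rw (wlc (M.hom t s) (of (preComp f g t))) (M.m x t s))
      (comp (lw (wl (M.hom t s) (pre g t)) (preAct f t s))
        (rw (preAct g t s) (pre f s)) (by simp)) (by simp) =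
    comp (preAct (compMor f g) t s) (lw (M.m z t s) (of (preComp f g s))) (by simp) := by
  have hA := exchange (nR (M.m z t s) g) (preAct f z s)
  have hB := comp_rotate' (preAct_act f z t s)
  have hB' := congrArg (lw (wl (M.hom t s) (insR g (M.hom z t)))) hB
  have e : preAct (compMor f g) t s =
      comp (lw (wl (M.hom t s) (insR g (M.hom z t) ≫ wl (M.hom z t) (pre f z)))
          (M.assoc x z t s).symm)
        (rw (nR (M.m z t s) (g ≫ pre f z)) (M.m x z s)) (by simp [insR_comp]) := by
    simp [preAct, compMor_eq, insR_comp]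
  simp at hA hB'
  simp only [e]
  simp [of_preComp, nR_comp_right, hA]
  simp [preAct_eq g, pre_eq g]
  simp only [comp_comp_comp_congr hB']

/-- The 2-isomorphisms `(g ∘ f)^* ≅ f^* ∘ g^*` are compatible with associativity. -/
theorem preComp_assoc (f : M.Mor x y) (g : M.Mor y z) (h : M.Mor z t) (s : M.Obj) :
    comp (of (preIso (assocMor f g h) s))
      (comp (of (preComp (compMor f g) h s)) (lw (pre h s) (of (preComp f g s))) (by simp))
      (by simp) =
    comp (of (preComp f (compMor g h) s)) (rw (of (preComp g h s)) (pre f s)) (by simp) := by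
  -- Fixing `b = h` leaves the first entry of the pentagon free.
  have hA := congrArg (lw (insR h (M.hom t s))) (preAct_compMor f g t s)
  simp only [of_preIso_assocMor]
  simp [of_preComp] at hA
  have hB := eq_symm_comp hA
  simp [of_preComp, pre_eq h, compMor_eq g h, insR_comp]
  simp [hB]

/-- The interchangers are compatible with the composition of pullbacks. -/
theorem exch_compMor_pre {u : M.Obj} (f : M.Mor x y) (g : M.Mor y z) (h : M.Mor t u) :
    comp (of (exch (compMor f g) h)) (lw (post h z) (of (preComp f g u))) (by simp) =
      comp (rw (of (preComp f g t)) (post h x))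
        (comp (lw (pre g t) (of (exch f h))) (rw (of (exch g h)) (pre f u)) (by simp))
        (by simp) := by
  -- Fixing `c = h` leaves the second entry free. `hB` and `hC` move `h` past the cells for `f` and
  -- `g`.
  have hA := congrArg (lw (insL h (M.hom z t))) (preAct_compMor f g t u)
  have hB := congrArg (fun c => rw c (M.m x t u)) (nL_naturality h (of (preComp f g t)))
  have hC := exchange (nL h (pre g t)) (preAct f t u)
  simp at hA hB hC
  simp [of_exch, post_eq, ← hA]
  simp [← comp_comp_congr hB, nL_comp, comp_comp_congr hC]

/-- The interchangers are compatible with the composition of push-forwards. -/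
theorem exch_compMor_post {u : M.Obj} (f : M.Mor x y) (g : M.Mor z t) (h : M.Mor t u) :
    comp (of (exch f (compMor g h))) (rw (of (postComp g h y)) (pre f u)) (by simp) =
      comp (lw (pre f z) (of (postComp g h x)))
        (comp (rw (of (exch f g)) (post h x)) (lw (post g y) (of (exch f h))) (by simp))
        (by simp) := by
  have hN := congrArg (fun c => rw c (M.m x t u)) (nL_naturality h (of (exch f g)))
  have n1 := nL_comp h (post g y) (pre f t)
  have n2 := nL_comp h (pre f z) (post g x)
  simp [n1, n2] at hN
  have hN' := comp_rotate'' hN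
  have hD := exchange (nL h (pre f z)) (lw (wl (M.hom t u) (insL g (M.hom x z))) (M.assoc x z t u))
  have hE := exchange (nL h (post g y)).symm (preAct f t u)
  -- With `h` and `g` as the first two entries, only the third remains free.
  have hF := congrArg (lw (insL h (M.hom y z) ≫ wl (M.hom t u) (insL g (M.hom y z))))
    (preAct_act f z t u)
  have hG := congrArg (lw (insL h (M.hom y z)))
    (exchange (wlc (M.hom t u) (nL g (pre f z))) (M.assoc x z t u))
  simp [post_eq] at hN' hD hE hF hG
  simp only [of_exch f (compMor g h), of_exch f h, of_postComp]
  simp [insL_compMor, nL_compMor, post_eq]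
  simp only [comp_comp_comp_congr hF.symm, comp_comp_congr hG, comp_comp_congr hD,
    comp_comp_comp_congr hN', hE]
  simp [of_exch f g]

/-- The 2-isomorphisms `(g ∘ f)_* ≅ g_* ∘ f_*` are compatible with associativity. -/
theorem postComp_assoc (f : M.Mor x y) (g : M.Mor y z) (h : M.Mor z t) (s : M.Obj) :
    comp (of (postIso (assocMor f g h) s))
      (comp (of (postComp (compMor f g) h s)) (rw (of (postComp f g s)) (post h s)) (by simp))
      (by simp) =
    comp (of (postComp f (compMor g h) s)) (lw (post f s) (of (postComp g h s))) (by simp) := by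
  have hN := congrArg (fun c => rw c (M.m s z t)) (nL_naturality h (of (postComp f g s)))
  have n1 := nL_comp h (post f s) (post g s)
  simp only [rw_comp, of_src, of_tgt] at hN
  have hN' := comp_square hN
  -- The pentagon with first three entries `h`, `g`, `f` and the last one free.
  have hP := congrArg (lw (insL h (M.hom s x) ≫ wl (M.hom z t) (insL g (M.hom s x)) ≫
    wl (M.hom z t) (wl (M.hom y z) (insL f (M.hom s x))))) (M.pentagon_assoc s x y z t)
  have hX := congrArg (lw (insL h (M.hom s x) ≫ wl (M.hom z t) (insL g (M.hom s x))))
    (exchange (nA (M.m y z t) (insL f (M.hom s x))).symm (M.assoc s x y t))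
  have hY := congrArg (lw (insL h (M.hom s x)))
    (exchange (wlc (M.hom z t) (nL g (post f s))).symm (M.assoc s y z t))
  have hZ := exchange (nL h (post f s)).symm
    (lw (wl (M.hom z t) (insL g (M.hom s y))) (M.assoc s y z t))
  simp only [of_postIso_assocMor, of_postComp f (compMor g h), of_postComp g h,
    of_postComp (compMor f g)]
  simp [n1] at hN'
  simp [post_eq, insL_compMor] at hN' hP hX hY hZ
  simp [insL_compMor, nL_compMor, post_eq, preActTensor, nA_comp]
  simp only [hN']
  simp [of_postComp]
  simp [post_eq]
  simp only [comp_comp_congr hZ, comp_comp_congr hY, comp_comp_comp_congr hP, comp_comp_congr hX]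

end EnrichedBicategory
end LaxSpan

/-! ### The pasting that defines a laxator. -/

namespace LaxSpan

open GrayMonoid ICell EnrichedBicategory

theorem Lift.comm_bundled {C : Type u} [Bicategory.{w, v} C] [Bicategory.Strict C] {X Y Z : C}
    {f : X ⟶ Z} {g : Y ⟶ Z} {P : TwoFiberProduct f g} {A : C} {p : A ⟶ X} {q : A ⟶ Y}
    {ξ : p ≫ f ≅ q ≫ g} (L : Lift P p q ξ) :
    comp (rw (of L.fstIso) f) (of ξ) (by simp) =
      comp (lw L.hom (of P.cell)) (rw (of L.sndIso) g) (by simp) := by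
  have e : whiskerRightIso L.fstIso f ≪≫ ξ =
      α_ _ _ _ ≪≫ whiskerLeftIso L.hom P.cell ≪≫ (α_ _ _ _).symm ≪≫
        whiskerRightIso L.sndIso g := by
    ext
    exact L.comm
  simpa using congrArg of e

variable {C : Type u} [Bicategory.{w, v} C] [Bicategory.Strict C] [GrayMonoid C]
variable {M : EnrichedBicategory.{w, v, u, u'} C} {x y z t : M.Obj}

/-- The pasting defining the laxator, over an arbitrary square over `A_f` and `A_g`. -/
def laxCell {f : M.Mor x y} {g : M.Mor y z} (Af : FiberAlg f) (Ag : FiberAlg g) {A : C}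
    {p : A ⟶ Af.pt} {q : A ⟶ Ag.pt} (σ : p ≫ Af.snd ≅ q ≫ Ag.fst) : ICell A (M.hom x z) :=
  comp (lw (p ≫ Af.fst) (of (postComp f g x)))
    (comp (lw p (rw (of Af.cell) (post g x)))
      (comp (rw (of σ) (pre f y ≫ post g x))
        (comp (lw (q ≫ Ag.fst) (of (exch f g)))
          (comp (lw q (rw (of Ag.cell) (pre f z)))
            (lw (q ≫ Ag.snd) (of (preComp f g z)).symm) (by simp)) (by simp)) (by simp))
      (by simp)) (by simp)

section

variable {f : M.Mor x y} {g : M.Mor y z} {Af : FiberAlg f} {Ag : FiberAlg g} {A B : C}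
  {p p' : A ⟶ Af.pt} {q q' : A ⟶ Ag.pt}

@[simp] theorem laxCell_src (σ : p ≫ Af.snd ≅ q ≫ Ag.fst) :
    (laxCell Af Ag σ).src = p ≫ Af.fst ≫ post (compMor f g) x := by
  simp [laxCell]

@[simp] theorem laxCell_tgt (σ : p ≫ Af.snd ≅ q ≫ Ag.fst) :
    (laxCell Af Ag σ).tgt = q ≫ Ag.snd ≫ pre (compMor f g) z := by
  simp [laxCell]

theorem of_laxatorCell (P : TwoFiberProduct Af.snd Ag.fst) :
    of (laxatorCell Af Ag P) = laxCell Af Ag P.cell := by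
  simp [laxatorCell, laxCell]

theorem lw_laxCell (k : B ⟶ A) (σ : p ≫ Af.snd ≅ q ≫ Ag.fst) :
    lw k (laxCell Af Ag σ) =
      laxCell Af Ag (p := k ≫ p) (q := k ≫ q)
        (α_ _ _ _ ≪≫ whiskerLeftIso k σ ≪≫ (α_ _ _ _).symm) := by
  simp [laxCell]

/-- The hypothesis `H` is needed only in the layer of `σ`; the other five layers slide past `α` or
`β` by interchange. -/
theorem laxCell_naturality (α : p ≅ p') (β : q ≅ q') (σ : p ≫ Af.snd ≅ q ≫ Ag.fst)
    (σ' : p' ≫ Af.snd ≅ q' ≫ Ag.fst)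
    (H : comp (rw (of α) Af.snd) (of σ') (by simp) =
      comp (of σ) (rw (of β) Ag.fst) (by simp)) :
    comp (rw (of α) (Af.fst ≫ post (compMor f g) x)) (laxCell Af Ag σ') (by simp) =
      comp (laxCell Af Ag σ) (rw (of β) (Ag.snd ≫ pre (compMor f g) z)) (by simp) := by
  have h1 := exchange (of α) (lw Af.fst (of (postComp f g x)))
  have h2 := exchange (of α) (rw (of Af.cell) (post g x))
  have h3 := congrArg (fun c => rw c (pre f y ≫ post g x)) H
  have h4 := exchange (of β) (lw Ag.fst (of (exch f g)))
  have h5 := exchange (of β) (rw (of Ag.cell) (pre f z))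
  have h6 := exchange (of β) (lw Ag.snd (of (preComp f g z)).symm)
  simp at h1 h2 h3 h4 h5 h6
  simp [laxCell]
  simp only [comp_comp_congr h1, comp_comp_congr h2, comp_comp_congr h3, comp_comp_congr h4,
    comp_comp_congr h5, h6]

end

end LaxSpan

/-! ### The two composites as lifts of pastings over the triple fiber product. -/

namespace LaxSpan

open GrayMonoid ICell EnrichedBicategory

variable {C : Type u} [Bicategory.{w, v} C] [Bicategory.Strict C] [GrayMonoid C]
variable {M : EnrichedBicategory.{w, v, u, u'} C} {x y z t : M.Obj}
  {f : M.Mor x y} {g : M.Mor y z} {h : M.Mor z t}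
  {Af : FiberAlg f} {Ag : FiberAlg g} {Ah : FiberAlg h}
  {Pfg : TwoFiberProduct Af.snd Ag.fst} {Pgh : TwoFiberProduct Ag.snd Ah.fst}
  {Agf : FiberAlg (compMor f g)} {Ahg : FiberAlg (compMor g h)}
  {Q : TwoFiberProduct Agf.snd Ah.fst} {R : TwoFiberProduct Af.snd Ahg.fst}
  {Ahgf : FiberAlg (compMor (compMor f g) h)} {Ahgf' : FiberAlg (compMor f (compMor g h))}
  {Φ : Laxator Af Ag Pfg Agf} {Ψ : Laxator Ag Ah Pgh Ahg}

/-- The pasting over the triple 2-fiber product in which `f` and `g` are composed first. -/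
def leftPasting (T : TripleFiberProduct Pfg Pgh) : ICell T.pt (M.hom x t) :=
  comp (lw (T.fst ≫ Pfg.fst ≫ Af.fst) (of (postComp (compMor f g) h x)))
    (comp (lw T.fst (rw (laxCell Af Ag Pfg.cell) (post h x)))
      (comp (rw (of T.cell) (Ag.snd ≫ pre (compMor f g) z ≫ post h x))
        (comp (lw T.snd (rw (of Pgh.cell) (pre (compMor f g) z ≫ post h x)))
          (comp (lw (T.snd ≫ Pgh.snd ≫ Ah.fst) (of (exch (compMor f g) h)))
            (comp (lw (T.snd ≫ Pgh.snd) (rw (of Ah.cell) (pre (compMor f g) t)))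
              (lw (T.snd ≫ Pgh.snd ≫ Ah.snd) (of (preComp (compMor f g) h t)).symm)
                (by simp)) (by simp)) (by simp)) (by simp)) (by simp)) (by simp)

/-- The pasting over the triple 2-fiber product in which `g` and `h` are composed first. -/
def rightPasting (T : TripleFiberProduct Pfg Pgh) : ICell T.pt (M.hom x t) :=
  comp (lw (T.fst ≫ Pfg.fst ≫ Af.fst) (of (postIso (assocMor f g h) x)).symm)
    (comp (lw (T.fst ≫ Pfg.fst ≫ Af.fst) (of (postComp f (compMor g h) x)))
      (comp (lw (T.fst ≫ Pfg.fst) (rw (of Af.cell) (post (compMor g h) x)))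
        (comp (lw T.fst (rw (of Pfg.cell) (pre f y ≫ post (compMor g h) x)))
          (comp (rw (of T.cell) (Ag.fst ≫ pre f y ≫ post (compMor g h) x))
            (comp (lw (T.snd ≫ Pgh.fst ≫ Ag.fst) (of (exch f (compMor g h))))
              (comp (lw T.snd (rw (laxCell Ag Ah Pgh.cell) (pre f t)))
                (comp (lw (T.snd ≫ Pgh.snd ≫ Ah.snd) (of (preComp f (compMor g h) t)).symm)
                  (lw (T.snd ≫ Pgh.snd ≫ Ah.snd) (of (preIso (assocMor f g h) t)))
                    (by simp)) (by simp)) (by simp)) (by simp)) (by simp)) (by simp))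
      (by simp)) (by simp)

@[simp] theorem leftPasting_src (T : TripleFiberProduct Pfg Pgh) :
    (leftPasting T).src =
      T.fst ≫ Pfg.fst ≫ Af.fst ≫ post (compMor (compMor f g) h) x := by
  simp [leftPasting]

@[simp] theorem rightPasting_src (T : TripleFiberProduct Pfg Pgh) :
    (rightPasting T).src =
      T.fst ≫ Pfg.fst ≫ Af.fst ≫ post (compMor (compMor f g) h) x := by
  simp [rightPasting]

variable {T : TripleFiberProduct Pfg Pgh}

theorem laxator_comm (Φ : Laxator Af Ag Pfg Agf) :
    comp (rw (of Φ.fstIso) (post (compMor f g) x)) (laxCell Af Ag Pfg.cell) (by simp) =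
      comp (lw Φ.hom (of Agf.cell)) (rw (of Φ.sndIso) (pre (compMor f g) z)) (by simp) := by
  simpa [of_laxatorCell] using Φ.comm_bundled

/-- The universal property of `Φ'` gives a `laxCell` over `Q`, and that of `L` carries it to `T`.
There `Φ.sndIso`, which enters through `whiskerRightCell`, meets the cell of `Agf`, and
`laxator_comm Φ` replaces both by the pasting for `f` and `g`. -/
theorem left_comm (L : LaxatorProdId Φ T Q) (Φ' : Laxator Agf Ah Q Ahgf) :
    comp (rw (of (leftFstIso L Φ')) (post (compMor (compMor f g) h) x)) (leftPasting T)
        (by simp) =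
      comp (lw (L.hom ≫ Φ'.hom) (of Ahgf.cell))
        (rw (of (leftSndIso L Φ')) (pre (compMor (compMor f g) h) t)) (by simp) := by
  have hΦ' := congrArg (lw L.hom) (laxator_comm Φ')
  have hL := L.comm_bundled
  have hN := laxCell_naturality L.fstIso L.sndIso
    (α_ _ _ _ ≪≫ whiskerLeftIso L.hom Q.cell ≪≫ (α_ _ _ _).symm) (whiskerRightCell Φ T)
    (by simpa using hL)
  simp only [← lw_laxCell] at hN
  have hX := congrArg (lw T.fst) (exchange (of Φ.fstIso) (of (postComp (compMor f g) h x)))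
  have hΦ := congrArg (fun c => lw T.fst (rw c (post h x))) (laxator_comm Φ)
  simp at hΦ' hN hX hΦ
  have hY := comp_comp_congr hΦ'
    (e := rw (of L.sndIso) (Ah.snd ≫ pre (compMor (compMor f g) h) t)) (by simp)
  simp only [← hN] at hY
  simp [leftFstIso, leftSndIso, leftPasting]
  simp only [comp_comp_congr hX, comp_comp_congr hΦ]
  simp [laxCell, whiskerRightCell] at hY
  exact hY

theorem of_whiskerLeftCell (Ψ : Laxator Ag Ah Pgh Ahg) :
    of (whiskerLeftCell Ψ T) =
      comp (lw T.fst (of Pfg.cell)) (comp (rw (of T.cell) Ag.fst) (lw T.snd (of Ψ.fstIso).symm)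
        (by simp)) (by simp) := by
  simp [whiskerLeftCell]

/-- As for the other composite, with the comparison `K` contributing the outer `assocMor` cells. The
inverse of `Ψ.fstIso` in `whiskerLeftCell` slides past the interchanger of `f` with `h ∘ g` and
cancels against the one produced by `laxator_comm Ψ`. -/
theorem right_comm (L : IdProdLaxator Ψ T R) (Ψ' : Laxator Af Ahg R Ahgf')
    (K : Reindex (assocMor f g h) Ahgf' Ahgf) :
    comp (rw (of (rightFstIso L Ψ' K)) (post (compMor (compMor f g) h) x)) (rightPasting T)
        (by simp) =
      comp (lw (L.hom ≫ Ψ'.hom ≫ K.hom) (of Ahgf.cell))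
        (rw (of (rightSndIso L Ψ' K)) (pre (compMor (compMor f g) h) t)) (by simp) := by
  have hK := congrArg (lw (L.hom ≫ Ψ'.hom)) K.comm_bundled
  have hΨ' := congrArg (lw L.hom) (laxator_comm Ψ')
  have hN := laxCell_naturality L.fstIso L.sndIso
    (α_ _ _ _ ≪≫ whiskerLeftIso L.hom R.cell ≪≫ (α_ _ _ _).symm) (whiskerLeftCell Ψ T)
    (by simpa using L.comm_bundled)
  simp only [← lw_laxCell] at hN
  have hΨ := congrArg (fun c => lw T.snd (rw c (pre f t))) (laxator_comm Ψ)
  have e1 := congrArg (lw T.snd) (exchange (of Ψ.fstIso).symm (of (exch f (compMor g h))))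
  have e2 := congrArg (lw T.snd) (exchange (of Ψ.sndIso) (of (preComp f (compMor g h) t)).symm)
  have e3 := congrArg (lw L.hom) (exchange (of Ψ'.fstIso) (of (postIso (assocMor f g h) x)).symm)
  have e4 := exchange (of L.fstIso) (lw Af.fst (of (postIso (assocMor f g h) x)).symm)
  have e5 := congrArg (lw L.hom) (exchange (of Ψ'.sndIso) (of (preIso (assocMor f g h) t)))
  have e6 := exchange (of L.sndIso) (lw Ahg.snd (of (preIso (assocMor f g h) t)))
  have e7 := congrArg (lw T.snd) (exchange (of Ψ.sndIso) (of (preIso (assocMor f g h) t)))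
  simp at hK hΨ' hN hΨ e1 e2 e3 e4 e5 e6 e7
  -- Cancellation in normal form: the inverse has been pushed inside the whiskerings, where
  -- `symm_comp_assoc` no longer applies syntactically.
  have hc : ∀ (b : ICell T.pt (M.hom x t)) k k',
      comp (lw T.snd (rw (of Ψ.fstIso).symm (post (compMor g h) y ≫ pre f t)))
        (comp (lw T.snd (rw (of Ψ.fstIso) (post (compMor g h) y ≫ pre f t))) b k) k' = b :=
    symm_comp_assoc (lw T.snd (rw (of Ψ.fstIso) (post (compMor g h) y ≫ pre f t)))
  have hW := laxCell.eq_1 Af Ahg (whiskerLeftCell Ψ T)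
  simp [of_whiskerLeftCell] at hW
  simp only [comp_comp_congr e1] at hW
  simp [rightFstIso, rightSndIso, rightPasting]
  simp only [comp_comp_congr e4, comp_comp_congr e3, comp_comp_congr hK.symm]
  simp
  simp only [comp_comp_congr e5.symm, comp_comp_congr e6.symm, e7.symm,
    comp_comp_congr hΨ'.symm, comp_comp_congr hN.symm, hW]
  simp only [comp_assoc, comp_comp_congr e2.symm, comp_comp_congr hΨ.symm, hc]

end LaxSpan

/-! ### Equality of the two pastings. -/

namespace LaxSpan

open GrayMonoid ICell EnrichedBicategory

variable {C : Type u} [Bicategory.{w, v} C] [Bicategory.Strict C] [GrayMonoid C]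
variable {M : EnrichedBicategory.{w, v, u, u'} C} {x y z t : M.Obj}
  {f : M.Mor x y} {g : M.Mor y z} {h : M.Mor z t}
  {Af : FiberAlg f} {Ag : FiberAlg g} {Ah : FiberAlg h}
  {Pfg : TwoFiberProduct Af.snd Ag.fst} {Pgh : TwoFiberProduct Ag.snd Ah.fst}
  {Agf : FiberAlg (compMor f g)} {Ahg : FiberAlg (compMor g h)}
  {Q : TwoFiberProduct Agf.snd Ah.fst} {R : TwoFiberProduct Af.snd Ahg.fst}
  {Ahgf : FiberAlg (compMor (compMor f g) h)} {Ahgf' : FiberAlg (compMor f (compMor g h))}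
  {Φ : Laxator Af Ag Pfg Agf} {Ψ : Laxator Ag Ah Pgh Ahg}

attribute [local irreducible] ICell.comp ICell.lw ICell.rw

theorem leftPasting_eq_rightPasting (T : TripleFiberProduct Pfg Pgh) :
    leftPasting T = rightPasting T := by
  -- `x3`, `x5`, `x6` and `x12` are the four coherence equations. The others are interchange laws
  -- that bring the cells in question next to each other.
  have x1 := exchange (of T.cell) (lw Ag.snd (rw (of (preComp f g z)).symm (post h x)))
  have x2 := congrArg (lw T.snd)
    (exchange (of Pgh.cell) (rw (of (preComp f g z)).symm (post h x)))
  have x3 := congrArg (lw (T.snd ≫ Pgh.snd ≫ Ah.fst))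
    (comp_square (exch_compMor_pre f g h))
  have x4 := congrArg (lw (T.snd ≫ Pgh.snd)) (exchange (of Ah.cell) (of (preComp f g t)).symm)
  have x5 := congrArg (lw (T.snd ≫ Pgh.snd ≫ Ah.snd))
    (eq_symm_comp (comp_square (preComp_assoc f g h t)).symm)
  have x6 := congrArg (lw (T.fst ≫ Pfg.fst ≫ Af.fst)) (eq_symm_comp (postComp_assoc f g h x))
  have x7 := congrArg (lw (T.fst ≫ Pfg.fst)) (exchange (of Af.cell) (of (postComp g h x)))
  have x8 := congrArg (lw T.fst) (exchange (of Pfg.cell) (lw (pre f y) (of (postComp g h x))))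
  have x9 := exchange (of T.cell) (lw (Ag.fst ≫ pre f y) (of (postComp g h x)))
  have x10 := exchange (of T.cell) (lw Ag.fst (rw (of (exch f g)) (post h x)))
  have x11 := exchange (of T.cell) (rw (of Ag.cell) (pre f z ≫ post h x))
  have x12 := congrArg (lw (T.snd ≫ Pgh.fst ≫ Ag.fst)) (exch_compMor_post f g h)
  have x13 := congrArg (lw (T.snd ≫ Pgh.fst)) (exchange (of Ag.cell) (of (exch f h)))
  have x14 := congrArg (lw T.snd) (exchange (of Pgh.cell) (lw (pre g z) (of (exch f h))))
  simp at x1 x2 x3 x4 x5 x6 x7 x8 x9 x10 x11 x12 x13 x14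
  simp [leftPasting, rightPasting, laxCell]
  simp only [comp_comp_congr x6, comp_assoc]
  simp only [comp_comp_congr x7.symm]
  simp only [comp_comp_congr x8.symm]
  simp only [comp_comp_congr x1.symm]
  simp only [comp_comp_congr x2.symm]
  simp only [comp_comp_congr x3, comp_assoc]
  simp only [comp_comp_congr x4.symm]
  simp only [x5]
  simp only [comp_comp_congr x11.symm]
  simp only [comp_comp_congr x10.symm]
  simp only [comp_comp_congr x9.symm]
  -- This expands the interchanger of `f` with `h ∘ g` in the right pasting; the resulting cell
  -- `exch f h` then slides past the cells of `Ag` and `Pgh` to its place in the left one.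
  simp only [comp_comp_congr x12, comp_assoc]
  simp only [comp_comp_congr x13.symm]
  simp only [comp_comp_congr x14.symm]

end LaxSpan

/-! ### The 2-universal property for invertible 2-cells. -/

namespace LaxSpan

open GrayMonoid ICell EnrichedBicategory

namespace TwoFiberProduct

variable {C : Type u} [Bicategory.{w, v} C] {X Y Z A : C} {f : X ⟶ Z} {g : Y ⟶ Z}

theorem hom_ext (P : TwoFiberProduct f g) {k l : A ⟶ P.pt} {θ θ' : k ⟶ l}
    (γ₁ : k ≫ P.fst ≅ l ≫ P.fst) (γ₂ : k ≫ P.snd ≅ l ≫ P.snd)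
    (H : γ₁.hom ▷ f ≫ (α_ l P.fst f).hom ≫ l ◁ P.cell.hom ≫ (α_ l P.snd g).inv =
      (α_ k P.fst f).hom ≫ k ◁ P.cell.hom ≫ (α_ k P.snd g).inv ≫ γ₂.hom ▷ g)
    (h₁ : θ ▷ P.fst = γ₁.hom) (h₂ : θ ▷ P.snd = γ₂.hom) (h₁' : θ' ▷ P.fst = γ₁.hom)
    (h₂' : θ' ▷ P.snd = γ₂.hom) : θ = θ' :=
  (P.existsUnique_cell k l _ _ H).unique ⟨h₁, h₂⟩ ⟨h₁', h₂'⟩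

theorem existsUnique_iso (P : TwoFiberProduct f g) {k l : A ⟶ P.pt}
    (γ₁ : k ≫ P.fst ≅ l ≫ P.fst) (γ₂ : k ≫ P.snd ≅ l ≫ P.snd)
    (H : γ₁.hom ▷ f ≫ (α_ l P.fst f).hom ≫ l ◁ P.cell.hom ≫ (α_ l P.snd g).inv =
      (α_ k P.fst f).hom ≫ k ◁ P.cell.hom ≫ (α_ k P.snd g).inv ≫ γ₂.hom ▷ g) :
    ∃! θ : k ≅ l, θ.hom ▷ P.fst = γ₁.hom ∧ θ.hom ▷ P.snd = γ₂.hom := by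
  -- Compatibility passes to the inverse pair, which therefore also lifts. The two lifts are
  -- mutually inverse because both composites whisker to identities.
  have H' : γ₁.inv ▷ f ≫ (α_ k P.fst f).hom ≫ k ◁ P.cell.hom ≫ (α_ k P.snd g).inv =
      (α_ l P.fst f).hom ≫ l ◁ P.cell.hom ≫ (α_ l P.snd g).inv ≫ γ₂.inv ▷ g := by
    rw [← cancel_epi (γ₁.hom ▷ f), ← cancel_mono (γ₂.hom ▷ g)]
    simpa using H.symm
  obtain ⟨θ, ⟨h₁, h₂⟩, hθ⟩ := P.existsUnique_cell k l _ _ H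
  obtain ⟨θ', ⟨h₁', h₂'⟩, -⟩ := P.existsUnique_cell l k _ _ H'
  refine ⟨⟨θ, θ', P.hom_ext (Iso.refl _) (Iso.refl _) (by simp) ?_ ?_ ?_ ?_,
    P.hom_ext (Iso.refl _) (Iso.refl _) (by simp) ?_ ?_ ?_ ?_⟩, ⟨h₁, h₂⟩,
    fun η hη => Iso.ext (hθ _ hη)⟩ <;> simp [h₁, h₂, h₁', h₂']

end TwoFiberProduct

section

variable {C : Type u} [Bicategory.{w, v} C] [Bicategory.Strict C] {X Y Z A : C} {f : X ⟶ Z}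
  {g : Y ⟶ Z}

/-- Two lifts of 2-cells which become equal are compared by a unique isomorphism. -/
theorem TwoFiberProduct.existsUnique_iso_of_comm (P : TwoFiberProduct f g) {k l : A ⟶ P.pt}
    {p : A ⟶ X} {q : A ⟶ Y} (ζ₁ : k ≫ P.fst ≅ p) (ζ₂ : k ≫ P.snd ≅ q) (η₁ : l ≫ P.fst ≅ p)
    (η₂ : l ≫ P.snd ≅ q) (c : ICell A Z) (hc : c.src = p ≫ f)
    (hk : comp (rw (of ζ₁) f) c (by simp [hc]) =
      comp (lw k (of P.cell)) (rw (of ζ₂) g) (by simp))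
    (hl : comp (rw (of η₁) f) c (by simp [hc]) =
      comp (lw l (of P.cell)) (rw (of η₂) g) (by simp)) :
    ∃! θ : k ≅ l, θ.hom ▷ P.fst = (ζ₁ ≪≫ η₁.symm).hom ∧
      θ.hom ▷ P.snd = (ζ₂ ≪≫ η₂.symm).hom := by
  refine P.existsUnique_iso _ _ ?_
  have e : whiskerRightIso (ζ₁ ≪≫ η₁.symm) f ≪≫ α_ l P.fst f ≪≫ whiskerLeftIso l P.cell ≪≫
      (α_ l P.snd g).symm = α_ k P.fst f ≪≫ whiskerLeftIso k P.cell ≪≫ (α_ k P.snd g).symm ≪≫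
        whiskerRightIso (ζ₂ ≪≫ η₂.symm) g := by
    have h2 := eq_symm_comp hl
    have h3 := comp_comp_congr (e := rw (of η₂).symm g) hk.symm (by simp)
    have h4 : comp (rw (of η₂) g) (rw (of η₂).symm g) (by simp) = ICell.id _ :=
      comp_symm (rw (of η₂) g) (by simp)
    refine of_injective ?_
    simp at h2 h3
    simp
    simp only [h3, h2, comp_assoc, h4, comp_id]
  simpa using congrArg Iso.hom e

end

end LaxSpan

theorem mainTheorem7 {C : Type u} [Bicategory.{w, v} C] [Bicategory.Strict C] [GrayMonoid C]
    (M : EnrichedBicategory.{w, v, u, u'} C) {x y z t : M.Obj}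
    (f : M.Mor x y) (g : M.Mor y z) (h : M.Mor z t)
    (Af : FiberAlg f) (Ag : FiberAlg g) (Ah : FiberAlg h)
    (Agf : FiberAlg (compMor f g)) (Ahg : FiberAlg (compMor g h))
    (Ahgf : FiberAlg (compMor (compMor f g) h)) (Ahgf' : FiberAlg (compMor f (compMor g h)))
    (Pfg : TwoFiberProduct Af.snd Ag.fst) (Pgh : TwoFiberProduct Ag.snd Ah.fst)
    (Q : TwoFiberProduct Agf.snd Ah.fst) (R : TwoFiberProduct Af.snd Ahg.fst)
    (T : TripleFiberProduct Pfg Pgh)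
    (Φfg : Laxator Af Ag Pfg Agf) (Φgh : Laxator Ag Ah Pgh Ahg)
    (Φgf_h : Laxator Agf Ah Q Ahgf) (Φf_hg : Laxator Af Ahg R Ahgf')
    (Φfg_one : LaxatorProdId Φfg T Q) (one_Φgh : IdProdLaxator Φgh T R)
    (K : Reindex (assocMor f g h) Ahgf' Ahgf) :
    ∃! Θ : Φfg_one.hom ≫ Φgf_h.hom ≅ one_Φgh.hom ≫ Φf_hg.hom ≫ K.hom,
      Θ.hom ▷ Ahgf.fst =
          (leftFstIso Φfg_one Φgf_h ≪≫ (rightFstIso one_Φgh Φf_hg K).symm).hom ∧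
        Θ.hom ▷ Ahgf.snd =
          (leftSndIso Φfg_one Φgf_h ≪≫ (rightSndIso one_Φgh Φf_hg K).symm).hom := by
  exact Ahgf.existsUnique_iso_of_comm _ _ _ _ (leftPasting T) (by simp) (left_comm Φfg_one Φgf_h)
    (by simpa only [leftPasting_eq_rightPasting] using right_comm one_Φgh Φf_hg K)
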